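/- Let $\ell, s, r$ be positive integers with $s$ and $\ell$ coprime. For $a,b>0$, $h\in\mathbb{R}$ and $j=1,\dots,s$ put $$X_j(h)=a\cos\Big(\tfrac1s[rh+2\pi(j-1)]\Big),\qquad Y_j(h)=\tfrac{b}{\ell}\sin\Big(\tfrac{\ell}{s}[rh+2\pi(j-1)]\Big),\qquad Z_j=X_j+\mathrm{i}Y_j .$$ The lemniscate link $L(s,r,\ell)$ is the closure in $\mathbb{R}^3$ of the braid with strands $(X_j(h),Y_j(h),h)$, $0\le h\le 2\pi$, that is, the set of points $$\big(\cos h\,(R+X_j(h)),\ \sin h\,(R+X_j(h)),\ Y_j(h)\big),\qquad j=1,\dots,s,\ h\in[0,2\pi],$$ for any choice of $a,b>0$ and $R>a$ (its isotopy type does not depend on the choice). It is regarded as a link in $S^3=\{(u,v)\in\mathbb{C}^2 : |u|^2+|v|^2=1\}$ through the inverse stereographic projection $$u=\frac{\varrho^2-1+2\mathrm{i}z}{\varrho^2+1},\qquad v=\frac{2(x+\mathrm{i}y)}{\varrho^2+1},\qquad \varrho^2=x^2+y^2+z^2 .$$ The function $p(u,h)=\prod_{j=1}^s (u-Z_j(h))$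 can be written in a unique way as a polynomial in $u$, $\mathrm{e}^{\mathrm{i}h}$ and $\mathrm{e}^{-\mathrm{i}h}$ in which no term contains both $\mathrm{e}^{\mathrm{i}h}$ and $\mathrm{e}^{-\mathrm{i}h}$; let $f(u,v,\overline v)$ be obtained from this expression by writing $v$ for $\mathrm{e}^{\mathrm{i}h}$ and $\overline v$ for $\mathrm{e}^{-\mathrm{i}h}$. Fix $a_1,b_1>0$, and for $\lambda>0$ let $f_\lambda$ be the polynomial $f$ for $a=\lambda a_1$, $b=\lambda b_1$. Then there is $\varepsilon>0$ (depending on $\ell,s,r,a_1,b_1$) such that for all $\lambda$ with $0<\lambda<\varepsilon$ the set $f_\lambda^{-1}(0)\cap S^3$ is ambient isotopic in $S^3$ to the lemniscate link $L(s,r,\ell)$, and every point of $f_\lambda^{-1}(0)\cap S^3$ is a regular point of $f_\lambda:\mathbb{C}^2\cong\mathbb{R}^4\to\mathbb{C}\cong\mathbb{R}^2$ and also of the restriction $f_\lambda|_{S^3}$ (the real derivative of $f_\lambda$ maps the tangent space of $S^3$ at the point onto $\mathbb{C}$). -/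

import Mathlib

open scoped ComplexConjugate

/-! ### Lemniscate braids -/

/-- First transverse coordinate of the strand number `j + 1` of the lemniscate braid at
height `h`. -/
noncomputable def strandX (s r : ℕ) (a : ℝ) (j : ℕ) (h : ℝ) : ℝ :=
  a * Real.cos ((r * h + 2 * Real.pi * j) / s)

/-- Second transverse coordinate of the strand number `j + 1` of the lemniscate braid at
height `h`. -/
noncomputable def strandY (s r l : ℕ) (b : ℝ) (j : ℕ) (h : ℝ) : ℝ :=
  b / l * Real.sin (l * ((r * h + 2 * Real.pi * j) / s))

/-- The strand as a complex number `Z = X + i Y`. -/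
noncomputable def strandZ (s r l : ℕ) (a b : ℝ) (j : ℕ) (h : ℝ) : ℂ :=
  strandX s r a j h + strandY s r l b j h * Complex.I

/-- The braid polynomial `p_h(u)`, whose roots are the strands at height `h`. -/
noncomputable def braidPoly (s r l : ℕ) (a b : ℝ) (h : ℝ) (u : ℂ) : ℂ :=
  ∏ j ∈ Finset.range s, (u - strandZ s r l a b j h)

/-! ### The semiholomorphic polynomial -/

/-- The value of the expression `∑ c (k, n) u ^ k (e ^ {i h}) ^ n`, where `k` is a natural number
and `n` an integer (so that `e ^ {- i h}` is allowed). -/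
noncomputable def trigEval (c : (ℕ × ℤ) →₀ ℂ) (h : ℝ) (u : ℂ) : ℂ :=
  c.sum fun m z => z * (u ^ m.1 * Complex.exp (h * Complex.I) ^ m.2)

/-- The value of the expression obtained from `∑ c (k, n) u ^ k (e ^ {i h}) ^ n` by writing `v` for
every `e ^ {i h}` and `conj v` for every `e ^ {- i h}`: the power `(e ^ {i h}) ^ n` becomes `v ^ n`
if `0 ≤ n`, and `(conj v) ^ (- n)` if `n ≤ 0`. -/
noncomputable def semiholEval (c : (ℕ × ℤ) →₀ ℂ) (u v : ℂ) : ℂ :=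
  c.sum fun m z => z * (u ^ m.1 * (v ^ m.2.toNat * conj v ^ (-m.2).toNat))

/-- The monomial `u ^ k (e ^ {i h}) ^ n` as a monoid homomorphism in `(u, h)`. -/
noncomputable def trigMonomial (m : ℕ × ℤ) : ℂ × Multiplicative ℝ →* ℂ where
  toFun x := x.1 ^ m.1 * Complex.exp (x.2.toAdd * Complex.I) ^ m.2
  map_one' := by simp
  map_mul' x y := by
    simp only [Prod.fst_mul, Prod.snd_mul, toAdd_mul, Complex.ofReal_add, add_mul, Complex.exp_add,
      mul_pow, mul_zpow]
    ring

theorem trigMonomial_injective : Function.Injective trigMonomial := by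
  rintro ⟨k, n⟩ ⟨k', n'⟩ hm
  have h1 := DFunLike.congr_fun hm ((2 : ℂ), Multiplicative.ofAdd (0 : ℝ))
  simp only [trigMonomial, MonoidHom.coe_mk, OneHom.coe_mk, toAdd_ofAdd, Complex.ofReal_zero,
    zero_mul, Complex.exp_zero, one_zpow, mul_one] at h1
  have hk : k = k' := by
    have h2 : (2 : ℕ) ^ k = 2 ^ k' := by exact_mod_cast h1
    exact Nat.pow_right_injective le_rfl h2
  subst hk
  by_contra hne
  have hn : ((n : ℂ) - n') ≠ 0 := by
    intro h0
    apply hne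
    have : (n : ℂ) = n' := sub_eq_zero.mp h0
    have : n = n' := by exact_mod_cast this
    rw [this]
  have h3 := DFunLike.congr_fun hm ((1 : ℂ), Multiplicative.ofAdd (Real.pi / (n - n') : ℝ))
  simp only [trigMonomial, MonoidHom.coe_mk, OneHom.coe_mk, toAdd_ofAdd, one_pow, one_mul,
    ← Complex.exp_int_mul] at h3
  have h4 : Complex.exp (Real.pi * Complex.I) = 1 := by
    have e : (Real.pi * Complex.I : ℂ) = n * (((Real.pi / (n - n') : ℝ) : ℂ) * Complex.I)
        - n' * (((Real.pi / (n - n') : ℝ) : ℂ) * Complex.I) := by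
      push_cast
      field_simp
    rw [e, Complex.exp_sub, h3, div_self (Complex.exp_ne_zero _)]
  rw [Complex.exp_pi_mul_I] at h4
  norm_num at h4

/-- A trigonometric expression is determined by its values. -/
theorem trigEval_injective {c c' : (ℕ × ℤ) →₀ ℂ} (H : ∀ h u, trigEval c h u = trigEval c' h u) :
    c = c' := by
  have hli : LinearIndependent ℂ
      (fun m : ℕ × ℤ => (trigMonomial m : ℂ × Multiplicative ℝ → ℂ)) :=
    (linearIndependent_monoidHom (ℂ × Multiplicative ℝ) ℂ).comp _ trigMonomial_injective
  refine hli.finsuppLinearCombination_injective ?_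
  funext x
  have := H x.2.toAdd x.1
  simpa [trigEval, trigMonomial, Finsupp.linearCombination_apply, Finsupp.sum,
    Finset.sum_apply] using this

/-- Every braid polynomial is a polynomial in `u`, `e ^ {i h}` and `e ^ {- i h}`. -/
theorem exists_trigEval (s r l : ℕ) (a b : ℝ) :
    ∃ c : (ℕ × ℤ) →₀ ℂ, ∀ h u, trigEval c h u = braidPoly s r l a b h u := by
  classical
  set w : ℂ := Complex.exp (2 * Real.pi * Complex.I / s) with hw
  have hw0 : w ≠ 0 := Complex.exp_ne_zero _
  have hws : w ^ (s : ℤ) = 1 := by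
    rcases Nat.eq_zero_or_pos s with rfl | hs
    · simp
    · rw [zpow_natCast]
      exact (Complex.isPrimitiveRoot_exp s hs.ne').pow_eq_one
  let S : ℕ × ℤ → ℂ → AddMonoidAlgebra ℂ (ℕ × ℤ) := fun m x => AddMonoidAlgebra.single m x
  let z : ℕ → AddMonoidAlgebra ℂ (ℕ × ℤ) := fun j =>
    S (0, 1) (a / 2 * w ^ (j : ℤ)) + S (0, -1) (a / 2 * w ^ (-(j : ℤ)))
      + S (0, (l : ℤ)) (b / (2 * l) * w ^ ((l : ℤ) * j))
      - S (0, -(l : ℤ)) (b / (2 * l) * w ^ (-(l : ℤ) * j))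
  -- the shift by one strand
  let σhom : Multiplicative (ℕ × ℤ) →* AddMonoidAlgebra ℂ (ℕ × ℤ) :=
    { toFun := fun m => S m.toAdd (w ^ m.toAdd.2)
      map_one' := by simp [S, AddMonoidAlgebra.one_def]
      map_mul' := fun m m' => by
        simp [S, AddMonoidAlgebra.single_mul_single, zpow_add₀ hw0] }
  let σ := AddMonoidAlgebra.lift ℂ (AddMonoidAlgebra ℂ (ℕ × ℤ)) (ℕ × ℤ) σhom
  have hσS : ∀ m x, σ (S m x) = S m (x * w ^ m.2) := by
    intro m x
    simp [σ, S, σhom, AddMonoidAlgebra.lift_single]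
  have hσcoeff : ∀ P m, (σ P).coeff m = P.coeff m * w ^ m.2 := by
    intro P m
    induction P using AddMonoidAlgebra.induction_linear with
    | zero => simp
    | add P Q hP hQ => simp [hP, hQ, add_mul]
    | single m' x =>
      have := hσS m' x
      simp only [S] at this
      rw [this]
      simp only [AddMonoidAlgebra.coeff_single, Finsupp.single_apply]
      split_ifs with e
      · rw [e]
      · simp
  have hσz : ∀ j, σ (z j) = z (j + 1) := by
    intro j
    simp only [z, map_add, map_sub, hσS]
    have e1 : ∀ x : ℂ, x * w ^ (j : ℤ) * w ^ (1 : ℤ) = x * w ^ ((j + 1 : ℕ) : ℤ) := by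
      intro x; rw [mul_assoc, ← zpow_add₀ hw0]; push_cast; ring_nf
    have e2 : ∀ x : ℂ, x * w ^ (-(j : ℤ)) * w ^ (-1 : ℤ) = x * w ^ (-((j + 1 : ℕ) : ℤ)) := by
      intro x; rw [mul_assoc, ← zpow_add₀ hw0]; push_cast; ring_nf
    have e3 : ∀ x : ℂ, ∀ n : ℤ, x * w ^ (n * j) * w ^ n = x * w ^ (n * ((j + 1 : ℕ) : ℤ)) := by
      intro x n; rw [mul_assoc, ← zpow_add₀ hw0]; push_cast; ring_nf
    rw [e1, e2, e3, e3]
  have hzs : z s = z 0 := by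
    have e : ∀ n : ℤ, w ^ (n * s) = 1 := by
      intro n; rw [mul_comm, zpow_mul, hws, one_zpow]
    have e' : w ^ (-(s : ℤ)) = 1 := by rw [zpow_neg, hws, inv_one]
    simp only [z, e, e', hws]
    simp
  let U := S (1, 0) 1
  let Q := ∏ j ∈ Finset.range s, (U - z j)
  have hQ : σ Q = Q := by
    have hU : σ U = U := by simp [U, hσS]
    simp only [Q, map_prod, map_sub, hU, hσz]
    have h1 := Finset.prod_range_succ (fun j => U - z j) s
    have h2 := Finset.prod_range_succ' (fun j => U - z j) s
    rcases Nat.eq_zero_or_pos s with hs0 | hs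
    · rw [hs0]; simp
    · obtain ⟨t, rfl⟩ : ∃ t, s = t + 1 := ⟨s - 1, by omega⟩
      rw [Finset.prod_range_succ, Finset.prod_range_succ' (fun j => U - z j), hzs]
  have hdvd : ∀ m ∈ Q.coeff.support, (s : ℤ) ∣ m.2 := by
    intro m hm
    have h1 := hσcoeff Q m
    rw [hQ] at h1
    have hne : Q.coeff m ≠ 0 := Finsupp.mem_support_iff.mp hm
    have h2 : w ^ m.2 = 1 := by
      have : Q.coeff m * w ^ m.2 = Q.coeff m * 1 := by rw [mul_one]; exact h1.symm
      exact mul_left_cancel₀ hne this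
    rcases Nat.eq_zero_or_pos s with hs0 | hs
    · have hQ1 : Q = 1 := by simp only [Q, hs0, Finset.range_zero, Finset.prod_empty]
      have h3 : m = 0 := by
        by_contra hm0
        apply hne
        rw [hQ1, AddMonoidAlgebra.one_def, AddMonoidAlgebra.coeff_single, Finsupp.single_apply,
          if_neg (Ne.symm hm0)]
      rw [h3]; simp
    · exact ((Complex.isPrimitiveRoot_exp s hs.ne').zpow_eq_one_iff_dvd _).mp h2
  refine ⟨Q.coeff.mapDomain fun m => (m.1, r * (m.2 / s)), fun h u => ?_⟩
  -- evaluation at `u` and at `e ^ {i r h / s}`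
  set q : ℂ := Complex.exp ((r * h / s : ℝ) * Complex.I) with hq
  have hq0 : q ≠ 0 := Complex.exp_ne_zero _
  let evhom : Multiplicative (ℕ × ℤ) →* ℂ :=
    { toFun := fun m => u ^ m.toAdd.1 * q ^ m.toAdd.2
      map_one' := by simp
      map_mul' := fun m m' => by
        simp only [toAdd_mul, Prod.fst_add, Prod.snd_add, pow_add, zpow_add₀ hq0]
        ring }
  let ev := AddMonoidAlgebra.lift ℂ ℂ (ℕ × ℤ) evhom
  have hevS : ∀ m x, ev (S m x) = x * (u ^ m.1 * q ^ m.2) := by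
    intro m x
    simp [ev, S, evhom, AddMonoidAlgebra.lift_single]
  have hev : ev Q = Q.coeff.sum fun m x => x * (u ^ m.1 * q ^ m.2) := by
    simp [ev, AddMonoidAlgebra.lift_apply, evhom]
  have hevz : ∀ j, ev (z j) = strandZ s r l a b j h := by
    intro j
    set t : ℝ := (r * h + 2 * Real.pi * j) / s with ht
    have key : ∀ n : ℤ, w ^ (n * j) * q ^ n = Complex.exp (n * (t * Complex.I)) := by
      intro n
      rw [hw, hq, ← Complex.exp_int_mul, ← Complex.exp_int_mul, ← Complex.exp_add]
      congr 1
      rw [ht]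
      push_cast
      ring
    have k1 := key 1
    have k2 := key (-1)
    have k3 := key l
    have k4 := key (-l)
    simp only [z, map_add, map_sub, hevS, strandZ, strandX, strandY, pow_zero, one_mul, ← ht]
    simp only [one_mul, neg_one_mul] at k1 k2
    rw [mul_assoc, mul_assoc, mul_assoc, mul_assoc, k1, k2, k3, k4]
    push_cast
    rw [Complex.cos, Complex.sin]
    have x1 : ((1 : ℤ) : ℂ) * (t * Complex.I) = t * Complex.I := by push_cast; ring
    have x2 : ((-1 : ℤ) : ℂ) * (t * Complex.I) = -t * Complex.I := by push_cast; ring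
    have x3 : (l : ℂ) * (t * Complex.I) = l * t * Complex.I := by ring
    have x4 : -(l : ℂ) * (t * Complex.I) = -(l * t) * Complex.I := by ring
    simp only [one_mul, x3, x4, neg_mul]
    rcases Nat.eq_zero_or_pos l with hl | hl
    · subst hl; simp; ring
    · have : (l : ℂ) ≠ 0 := by exact_mod_cast hl.ne'
      field_simp
      ring_nf
      rw [Complex.I_sq]
      ring
  have hevQ : ev Q = braidPoly s r l a b h u := by
    simp only [Q, map_prod, map_sub, hevz, braidPoly, U, hevS]
    simp
  rw [← hevQ, hev, trigEval, Finsupp.sum_mapDomain_index (by simp) (by intros; ring)]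
  refine Finset.sum_congr rfl fun m hm => ?_
  obtain ⟨d, hd⟩ := hdvd m hm
  have : Complex.exp (h * Complex.I) ^ ((r : ℤ) * (m.2 / s)) = q ^ m.2 := by
    rcases Nat.eq_zero_or_pos s with hs0 | hs
    · have : m.2 = 0 := by rw [hd, hs0]; simp
      simp [this]
    · have hs' : (s : ℂ) ≠ 0 := by exact_mod_cast hs.ne'
      rw [hd, Int.mul_ediv_cancel_left _ (by exact_mod_cast hs.ne'), hq, ← Complex.exp_int_mul,
        ← Complex.exp_int_mul]
      congr 1
      push_cast
      field_simp
  simp only [this]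

theorem existsUnique_trigEval (s r l : ℕ) (a b : ℝ) :
    ∃! c : (ℕ × ℤ) →₀ ℂ, ∀ h u, trigEval c h u = braidPoly s r l a b h u := by
  obtain ⟨c, hc⟩ := exists_trigEval s r l a b
  exact ⟨c, hc, fun c' hc' => trigEval_injective fun h u => by rw [hc', hc]⟩

/-- The coefficients of the braid polynomial as a polynomial in `u`, `e ^ {i h}`, `e ^ {- i h}`
(they exist and are unique by `existsUnique_trigEval`). -/
noncomputable def braidCoeff (s r l : ℕ) (a b : ℝ) : (ℕ × ℤ) →₀ ℂ :=
  (existsUnique_trigEval s r l a b).choose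

theorem trigEval_braidCoeff (s r l : ℕ) (a b h : ℝ) (u : ℂ) :
    trigEval (braidCoeff s r l a b) h u = braidPoly s r l a b h u :=
  (existsUnique_trigEval s r l a b).choose_spec.1 h u

/-- The semiholomorphic polynomial `f(u, v, conj v)` as a function of `(u, v)`: in the expression
of the braid polynomial, `v` is written for `e ^ {i h}` and `conj v` for `e ^ {- i h}`. -/
noncomputable def semiholPoly (s r l : ℕ) (a b : ℝ) (x : ℂ × ℂ) : ℂ :=
  semiholEval (braidCoeff s r l a b) x.1 x.2

/-! ### The three-sphere, links in it, and ambient isotopy -/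

/-- The unit three-sphere in complex coordinates `(u, v)`. -/
def S3 : Set (ℂ × ℂ) := {x | ‖x.1‖ ^ 2 + ‖x.2‖ ^ 2 = 1}

/-- The inverse stereographic projection from `ℝ³` to the three-sphere (onto the complement of the
point `(1, 0)`), with `ρ² = x² + y² + z²`:
`u = (ρ² - 1 + 2 i z) / (ρ² + 1)`, `v = 2 (x + i y) / (ρ² + 1)`. -/
noncomputable def invStereo (p : ℝ × ℝ × ℝ) : ℂ × ℂ :=
  let ρ2 : ℝ := p.1 ^ 2 + p.2.1 ^ 2 + p.2.2 ^ 2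
  ((ρ2 - 1 + 2 * Complex.I * p.2.2) / (ρ2 + 1), 2 * (p.1 + Complex.I * p.2.1) / (ρ2 + 1))

theorem invStereo_mem (p : ℝ × ℝ × ℝ) : invStereo p ∈ S3 := by
  obtain ⟨x, y, z⟩ := p
  have hpos : (0 : ℝ) < x ^ 2 + y ^ 2 + z ^ 2 + 1 := by positivity
  have e1 : invStereo (x, y, z) =
      ((⟨(x ^ 2 + y ^ 2 + z ^ 2 - 1) / (x ^ 2 + y ^ 2 + z ^ 2 + 1),
        2 * z / (x ^ 2 + y ^ 2 + z ^ 2 + 1)⟩ : ℂ),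
       (⟨2 * x / (x ^ 2 + y ^ 2 + z ^ 2 + 1), 2 * y / (x ^ 2 + y ^ 2 + z ^ 2 + 1)⟩ : ℂ)) := by
    have hne : ((x : ℂ) ^ 2 + y ^ 2 + z ^ 2 + 1) ≠ 0 := by exact_mod_cast hpos.ne'
    simp only [invStereo, Complex.mk_eq_add_mul_I]
    push_cast
    ext1
    · field_simp
    · field_simp
  rw [e1]
  simp only [S3, Set.mem_ofPred_eq, ← Complex.normSq_eq_norm_sq, Complex.normSq_mk]
  field_simp
  ring

/-- The closure in `ℝ³` of the lemniscate braid: the point `(X, Y, h)` of a strand goes to the point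
with radius `R + X`, height `Y` and azimuth `h` in cylindrical coordinates. All the `s` strands are
taken, so that this is a link in general. -/
def lemniscateLink (s r l : ℕ) (a b R : ℝ) : Set (ℝ × ℝ × ℝ) :=
  {p | ∃ j < s, ∃ h ∈ Set.Icc 0 (2 * Real.pi),
    p = (Real.cos h * (R + strandX s r a j h), Real.sin h * (R + strandX s r a j h),
      strandY s r l b j h)}

/-- Two subsets of a compact Hausdorff space are ambient isotopic if a continuous family of
self-homeomorphisms of the space that starts at the identity carries one to the other. -/
def AmbientIsotopic {M : Type*} [TopologicalSpace M] (K L : Set M) : Prop :=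
  ∃ H : unitInterval → (M ≃ₜ M), Continuous (fun p : unitInterval × M => H p.1 p.2) ∧
    H 0 = Homeomorph.refl M ∧ H 1 '' K = L

/-- The tangent space of the three-sphere at `x`, as the space of vectors of `ℂ²` that are
orthogonal to `x` for the real inner product. -/
def tangentS3 (x : ℂ × ℂ) : Set (ℂ × ℂ) :=
  {ξ | (conj x.1 * ξ.1 + conj x.2 * ξ.2).re = 0}

/-- `x` is a regular point of `f`: the real derivative of `f` at `x` has full rank. -/
def IsRegularPoint (f : ℂ × ℂ → ℂ) (x : ℂ × ℂ) : Prop :=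
  DifferentiableAt ℝ f x ∧ Function.Surjective (fderiv ℝ f x)

/-- `x` is a regular point of the restriction of `f` to the three-sphere: the derivative has full
rank on the tangent space of the sphere. -/
def IsRegularPointOnS3 (f : ℂ × ℂ → ℂ) (x : ℂ × ℂ) : Prop :=
  DifferentiableAt ℝ f x ∧ Set.SurjOn (fderiv ℝ f x) (tangentS3 x) Set.univ

/-!
The zeros on the three-sphere of the polynomial and the lemniscate link are both closed braids in
the solid torus `|u| < 1`, and a path of closed braids is an ambient isotopy.

*Closed braids.* The sphere is described by `(u, h) ↦ (u, √(1 - |u|²) e ^ {i h})` (`discCoord`),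
with `|u| ≤ 1`. A loop, in `h`, of homeomorphisms of the plane that fix every point with `|u| ≥ 1`
thus acts on the sphere (`ambientIsotopic_of_fibrewise`). If the strands of a closed braid are
displaced by little compared with their separation, then dragging along a small disc around each
strand, with weights that decrease linearly, is such a loop, since the identity plus a contraction
is a homeomorphism (`IsBraid.ambientIsotopic_of_near`). By compactness, closed braids in a
connected family are ambient isotopic (`ambientIsotopic_of_preconnected`).

*The lemniscate link.* In disc coordinates its strands are the images of `(R + X, Y)` under the map
`halfPlaneToDisc` from the right half-plane to the disc. The strands are distinct because `s` and
`l` are coprime (`strand_injective`), so that the isotopy type does not depend on `(a, b, R)`, which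
varies in a convex set. As `halfPlaneToDisc` is the identity to first order at `(1, 0)`, the link
with parameters `(t a₁, t b₁, 1)` is within `O(t²)` of the closed braid with strands `t Z j`, whose
separation is of order `t`.

*The zeros.* By homogeneity (`semiholPoly_smul`) the zeros are `u = t w`, where `w` is a root of
`w ↦ f (w, √(1 - t² |w|²) e ^ {i h})`, with `f` the polynomial for `a₁`, `b₁`. This `slicePoly` is a
`C¹`-small perturbation, for small `t` and bounded `w`, of the braid polynomial, whose roots
`Z j h` are simple. Hence it has exactly one root near each `Z j h`, by a Newton iteration
(`exists_root`), and no other one, because its roots are bounded uniformly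
(`exists_bound_of_semiholPoly_eq_zero`, as `f` is monic in `u`). The roots form a braid close to
`Z`, and `t` times it is within a small multiple of `t` of the braid `t Z`. The derivative of
`slicePoly` is also the derivative of the polynomial along tangent vectors of the sphere; it is
close to the multiplication by a non-zero number, therefore onto, which is the regularity
(`eventually_zeros_eq_closedBraid`).
-/

open Filter Topology

/-! ### Ambient isotopy as an equivalence relation -/

theorem AmbientIsotopic.trans {M : Type*} [TopologicalSpace M] {K L N : Set M}
    (h₁ : AmbientIsotopic K L) (h₂ : AmbientIsotopic L N) : AmbientIsotopic K N := by
  obtain ⟨F, hF, hF0, hF1⟩ := h₁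
  obtain ⟨G, hG, hG0, hG1⟩ := h₂
  refine ⟨fun t => (F t).trans (G t), ?_, ?_, ?_⟩
  · exact hG.comp (continuous_fst.prodMk hF)
  · change (F 0).trans (G 0) = _
    rw [hF0, hG0]; rfl
  · rw [← hG1, ← hF1, Set.image_image]; rfl

/-- On a compact Hausdorff space the inverse homeomorphisms again form a continuous family: the
total map `(t, x) ↦ (t, H t x)` is a continuous bijection of a compact Hausdorff space. -/
theorem AmbientIsotopic.symm {M : Type*} [TopologicalSpace M] [CompactSpace M] [T2Space M]
    {K L : Set M} (h : AmbientIsotopic K L) : AmbientIsotopic L K := by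
  obtain ⟨F, hF, hF0, hF1⟩ := h
  refine ⟨fun t => (F t).symm, ?_, ?_, ?_⟩
  · let e : unitInterval × M ≃ unitInterval × M :=
      { toFun := fun p => (p.1, F p.1 p.2)
        invFun := fun p => (p.1, (F p.1).symm p.2)
        left_inv := fun p => by simp
        right_inv := fun p => by simp }
    have he : Continuous e := continuous_fst.prodMk hF
    exact continuous_snd.comp (he.homeoOfEquivCompactToT2 (f := e)).symm.continuous
  · change (F 0).symm = _
    rw [hF0]; rfl
  · rw [← hF1, Set.image_image]; simp

/-! ### Disc coordinates on the three-sphere and closed braids -/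

/-- The map from (closed unit disc) × ℝ onto the three-sphere, with value `(u, v)` where
`arg v = h` and `|v| = √(1 - |u|²)`. It collapses `{u} × ℝ` to a point when `|u| = 1`. -/
noncomputable def discCoord (u : ℂ) (h : ℝ) : ℂ × ℂ :=
  (u, (Real.sqrt (1 - ‖u‖ ^ 2) : ℂ) * Complex.exp (h * Complex.I))

theorem continuous_discCoord : Continuous fun p : ℂ × ℝ => discCoord p.1 p.2 := by
  unfold discCoord
  fun_prop

theorem discCoord_mem {u : ℂ} (hu : ‖u‖ ≤ 1) (h : ℝ) : discCoord u h ∈ S3 := by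
  have h1 : 0 ≤ 1 - ‖u‖ ^ 2 := by nlinarith [norm_nonneg u]
  simp only [S3, discCoord, Set.mem_ofPred_eq, norm_mul, Complex.norm_exp_ofReal_mul_I, mul_one,
    Complex.norm_real, Real.norm_eq_abs, sq_abs, Real.sq_sqrt h1]
  ring

theorem discCoord_of_norm_eq_one {u : ℂ} (hu : ‖u‖ = 1) (h : ℝ) : discCoord u h = (u, 0) := by
  simp [discCoord, hu]

theorem norm_fst_le_one {x : ℂ × ℂ} (hx : x ∈ S3) : ‖x.1‖ ≤ 1 := by
  have : ‖x.1‖ ^ 2 + ‖x.2‖ ^ 2 = 1 := hx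
  nlinarith [norm_nonneg x.1, sq_nonneg ‖x.2‖]

theorem sqrt_one_sub_of_mem {x : ℂ × ℂ} (hx : x ∈ S3) : Real.sqrt (1 - ‖x.1‖ ^ 2) = ‖x.2‖ := by
  have : ‖x.1‖ ^ 2 + ‖x.2‖ ^ 2 = 1 := hx
  rw [← this, add_sub_cancel_left, Real.sqrt_sq (norm_nonneg _)]

theorem discCoord_arg {x : ℂ × ℂ} (hx : x ∈ S3) : discCoord x.1 x.2.arg = x := by
  rw [discCoord, sqrt_one_sub_of_mem hx, Complex.norm_mul_exp_arg_mul_I]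

theorem discCoord_add_int_mul (u : ℂ) (h : ℝ) (n : ℤ) :
    discCoord u (h + n * (2 * Real.pi)) = discCoord u h := by
  have : Complex.exp ((h + n * (2 * Real.pi) : ℝ) * Complex.I) = Complex.exp (h * Complex.I) := by
    rw [Complex.exp_eq_exp_iff_exists_int]
    exact ⟨n, by push_cast; ring⟩
  rw [discCoord, discCoord, this]

theorem exists_discCoord {x : ℂ × ℂ} (hx : x ∈ S3) :
    ∃ h ∈ Set.Icc 0 (2 * Real.pi), discCoord x.1 h = x := by
  rcases le_or_gt 0 x.2.arg with h0 | h0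
  · exact ⟨_, ⟨h0, by linarith [Complex.arg_le_pi x.2, Real.pi_pos]⟩, discCoord_arg hx⟩
  · refine ⟨x.2.arg + (1 : ℤ) * (2 * Real.pi), ⟨?_, ?_⟩, ?_⟩
    · push_cast; linarith [Complex.neg_pi_lt_arg x.2, Real.pi_pos]
    · push_cast; linarith
    · rw [discCoord_add_int_mul, discCoord_arg hx]

/-- Away from `|u| = 1` the disc coordinates determine the angle up to multiples of `2π`. -/
theorem exists_int_of_discCoord_eq {u u' : ℂ} {h h' : ℝ} (hu : ‖u‖ < 1)
    (H : discCoord u h = discCoord u' h') : u = u' ∧ ∃ n : ℤ, h = h' + n * (2 * Real.pi) := by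
  obtain ⟨h1, h2⟩ := Prod.ext_iff.mp H
  simp only [discCoord] at h1 h2
  subst h1
  refine ⟨rfl, ?_⟩
  have h3 : (Real.sqrt (1 - ‖u‖ ^ 2) : ℂ) ≠ 0 := by
    have : 0 < 1 - ‖u‖ ^ 2 := by nlinarith [norm_nonneg u]
    exact_mod_cast (Real.sqrt_pos.mpr this).ne'
  obtain ⟨n, hn⟩ := Complex.exp_eq_exp_iff_exists_int.mp (mul_left_cancel₀ h3 h2)
  refine ⟨n, ?_⟩
  have h4 : ((h : ℂ) - (h' + n * (2 * Real.pi))) * Complex.I = 0 := by linear_combination hn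
  have h5 : ((h - (h' + n * (2 * Real.pi)) : ℝ) : ℂ) = 0 := by
    push_cast
    exact (mul_eq_zero.mp h4).resolve_right Complex.I_ne_zero
  linarith [Complex.ofReal_eq_zero.mp h5]

/-- The subset of the three-sphere traced out by the strands `z 0, …, z (s - 1)` in disc
coordinates. -/
def closedBraid (s : ℕ) (z : ℕ → ℝ → ℂ) : Set S3 :=
  {x | ∃ j < s, ∃ h ∈ Set.Icc 0 (2 * Real.pi), (x : ℂ × ℂ) = discCoord (z j h) h}

/-- Continuous strands `z j`, numbered modulo `s`, such that a full turn sends the strand `j` to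
the strand `j + r`. -/
structure IsBraid (s r : ℕ) (z : ℕ → ℝ → ℂ) : Prop where
  continuous : ∀ j, Continuous (z j)
  add_strands : ∀ j, z (j + s) = z j
  add_turn : ∀ j h, z j (h + 2 * Real.pi) = z (j + r) h

instance compactSpace_S3 : CompactSpace S3 := by
  rw [← isCompact_iff_compactSpace]
  have : S3 = (fun p : ℂ × ℝ => discCoord p.1 p.2) ''
      (Metric.closedBall 0 1 ×ˢ Set.Icc 0 (2 * Real.pi)) := by
    ext x
    constructor
    · intro hx
      obtain ⟨h, hh, e⟩ := exists_discCoord hx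
      exact ⟨(x.1, h), ⟨by simpa using norm_fst_le_one hx, hh⟩, e⟩
    · rintro ⟨⟨u, h⟩, ⟨hu, -⟩, rfl⟩
      exact discCoord_mem (by simpa using hu) h
  rw [this]
  exact ((isCompact_closedBall _ _).prod isCompact_Icc).image continuous_discCoord

theorem add_int_mul_of_periodic {α : Type*} {f : ℝ → α} {T : ℝ} (hf : ∀ h, f (h + T) = f h)
    (h : ℝ) (n : ℤ) : f (h + n * T) = f h :=
  (Function.Periodic.int_mul hf n) h

/-- A loop of homeomorphisms of the plane that fix every point outside the open unit disc acts on
the three-sphere through disc coordinates; a path of such loops that starts at the identity is an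
ambient isotopy. Continuity across the circle `v = 0` holds because disc coordinates present
the three-sphere as a quotient of a compact space. -/
theorem ambientIsotopic_of_fibrewise (s : ℕ) (Φ : unitInterval → ℝ → ℂ → ℂ)
    (hc : Continuous fun p : unitInterval × ℝ × ℂ => Φ p.1 p.2.1 p.2.2)
    (hper : ∀ τ h, Φ τ (h + 2 * Real.pi) = Φ τ h)
    (hbij : ∀ τ h, Function.Bijective (Φ τ h))
    (hid : ∀ τ h u, 1 ≤ ‖u‖ → Φ τ h u = u) (h0 : ∀ h u, Φ 0 h u = u)
    {z : ℕ → ℝ → ℂ} (hz : ∀ j < s, ∀ h, ‖z j h‖ ≤ 1) :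
    AmbientIsotopic (closedBraid s z) (closedBraid s fun j h => Φ 1 h (z j h)) := by
  have hle : ∀ τ h u, ‖u‖ ≤ 1 → ‖Φ τ h u‖ ≤ 1 := by
    intro τ h u hu
    by_contra! hlt
    have := (hbij τ h).1 (hid τ h _ hlt.le)
    rw [this] at hlt
    exact hlt.not_ge hu
  let F : unitInterval → S3 → S3 := fun τ x =>
    ⟨discCoord (Φ τ (x : ℂ × ℂ).2.arg (x : ℂ × ℂ).1) (x : ℂ × ℂ).2.arg,
      discCoord_mem (hle _ _ _ (norm_fst_le_one x.2)) _⟩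
  have key : ∀ τ u h (hu : ‖u‖ ≤ 1), (F τ ⟨discCoord u h, discCoord_mem hu h⟩ : ℂ × ℂ)
      = discCoord (Φ τ h u) h := by
    intro τ u h hu
    change discCoord (Φ τ (discCoord u h).2.arg u) (discCoord u h).2.arg = _
    -- where `|u| = 1` the angle is lost, but there `Φ` is the identity
    rcases hu.lt_or_eq with hlt | heq
    · have e := discCoord_arg (discCoord_mem hu h)
      obtain ⟨-, n, hn⟩ := exists_int_of_discCoord_eq hlt e
      rw [hn, add_int_mul_of_periodic (hper τ), discCoord_add_int_mul]
    · rw [hid _ _ _ heq.ge, hid _ _ _ heq.ge, discCoord_of_norm_eq_one heq,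
        discCoord_of_norm_eq_one heq]
  have hsurj : ∀ x : S3, ∃ u h, ∃ hu : ‖u‖ ≤ 1, h ∈ Set.Icc 0 (2 * Real.pi) ∧
      x = ⟨discCoord u h, discCoord_mem hu h⟩ := by
    intro x
    obtain ⟨h, hh, e⟩ := exists_discCoord x.2
    exact ⟨_, h, norm_fst_le_one x.2, hh, Subtype.ext e.symm⟩
  have hFbij : ∀ τ, Function.Bijective (F τ) := by
    intro τ
    constructor
    · intro x x' hxx
      obtain ⟨u, h, hu, -, rfl⟩ := hsurj x
      obtain ⟨u', h', hu', -, rfl⟩ := hsurj x'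
      have e := congrArg Subtype.val hxx
      rw [key _ _ _ hu, key _ _ _ hu'] at e
      have e1 : Φ τ h u = Φ τ h' u' := (Prod.ext_iff.mp e).1
      apply Subtype.ext
      rcases (hle τ h u hu).lt_or_eq with hlt | heq
      · obtain ⟨-, n, hn⟩ := exists_int_of_discCoord_eq hlt e
        rw [hn, add_int_mul_of_periodic (hper τ)] at e1
        have e2 := (hbij τ h').1 e1
        simp only [e2, hn, discCoord_add_int_mul]
      · have a1 : Φ τ h u = u := (hbij τ h).1 (hid _ _ _ heq.ge)
        have a2 : Φ τ h' u' = u' := (hbij τ h').1 (hid _ _ _ (e1 ▸ heq).ge)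
        rw [a1] at e1 heq
        rw [a2] at e1
        subst e1
        simp only [discCoord_of_norm_eq_one heq]
    · intro y
      obtain ⟨w, h, hw, -, rfl⟩ := hsurj y
      obtain ⟨u, rfl⟩ := (hbij τ h).2 w
      have hu : ‖u‖ ≤ 1 := by
        by_contra! hlt
        rw [hid _ _ _ hlt.le] at hw
        exact hlt.not_ge hw
      exact ⟨⟨_, discCoord_mem hu h⟩, Subtype.ext (key τ u h hu)⟩
  have hFc : Continuous fun p : unitInterval × S3 => F p.1 p.2 := by
    let Q : unitInterval × (Metric.closedBall (0 : ℂ) 1) × (Set.Icc 0 (2 * Real.pi)) →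
        unitInterval × S3 := fun p =>
      (p.1, ⟨discCoord p.2.1 p.2.2, discCoord_mem (mem_closedBall_zero_iff.mp p.2.1.2) _⟩)
    have : CompactSpace (Metric.closedBall (0 : ℂ) 1) :=
      isCompact_iff_compactSpace.mp (isCompact_closedBall _ _)
    have hQ : Continuous Q := by
      refine continuous_fst.prodMk (Continuous.subtype_mk ?_ _)
      exact continuous_discCoord.comp ((continuous_subtype_val.comp (by fun_prop)).prodMk
        (continuous_subtype_val.comp (by fun_prop)))
    have hQs : Function.Surjective Q := by
      rintro ⟨τ, x⟩
      obtain ⟨u, h, hu, hh, rfl⟩ := hsurj x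
      exact ⟨(τ, ⟨u, by simpa using hu⟩, ⟨h, hh⟩), rfl⟩
    rw [(hQ.isClosedMap.isQuotientMap hQ hQs).continuous_iff,
      Topology.IsInducing.subtypeVal.continuous_iff]
    have e : (Subtype.val ∘ (fun p : unitInterval × S3 => F p.1 p.2) ∘ Q)
        = fun p => discCoord (Φ p.1 p.2.2 p.2.1) p.2.2 :=
      funext fun p => key _ _ _ (mem_closedBall_zero_iff.mp p.2.1.2)
    rw [e]
    refine continuous_discCoord.comp (Continuous.prodMk ?_ (by fun_prop))
    exact hc.comp (continuous_fst.prodMk (Continuous.prodMk (by fun_prop) (by fun_prop)))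
  let H : unitInterval → (S3 ≃ₜ S3) := fun τ =>
    Continuous.homeoOfEquivCompactToT2 (f := Equiv.ofBijective (F τ) (hFbij τ))
      (hFc.comp (continuous_const.prodMk continuous_id))
  refine ⟨H, hFc, ?_, ?_⟩
  · ext1 x
    obtain ⟨u, h, hu, -, rfl⟩ := hsurj x
    refine Subtype.ext ((key 0 u h hu).trans ?_)
    rw [h0]; rfl
  · ext y
    constructor
    · rintro ⟨x, ⟨j, hj, h, hh, hx⟩, rfl⟩
      refine ⟨j, hj, h, hh, ?_⟩
      have : x = ⟨discCoord (z j h) h, discCoord_mem (hz j hj h) h⟩ := Subtype.ext hx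
      rw [this]
      exact key _ _ _ (hz j hj h)
    · rintro ⟨j, hj, h, hh, hy⟩
      exact ⟨⟨discCoord (z j h) h, discCoord_mem (hz j hj h) h⟩, ⟨j, hj, h, hh, rfl⟩,
        Subtype.ext ((key _ _ _ (hz j hj h)).trans hy.symm)⟩

/-! ### Moving the strands of a closed braid -/

theorem sum_range_add_of_periodic {E : Type*} [AddCommGroup E] {s : ℕ} {g : ℕ → E}
    (hg : ∀ j, g (j + s) = g j) (r : ℕ) :
    ∑ j ∈ Finset.range s, g (j + r) = ∑ j ∈ Finset.range s, g j := by
  induction r with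
  | zero => rfl
  | succ r ih =>
    rw [← ih]
    have h1 := Finset.sum_range_succ (fun j => g (j + r)) s
    have h2 := Finset.sum_range_succ' (fun j => g (j + r)) s
    have h3 : g (s + r) = g (0 + r) := by rw [add_comm, hg, zero_add]
    rw [h1, h3] at h2
    simpa [add_assoc, add_comm 1] using (add_right_cancel h2).symm

theorem bijective_add_of_lipschitz_half {f : ℂ → ℂ} (hf : ∀ x y, ‖f x - f y‖ ≤ 1 / 2 * ‖x - y‖) :
    Function.Bijective fun w => w + f w := by
  have key : ApproximatesLinearOn (fun w => w + f w)
      ((ContinuousLinearEquiv.refl ℝ ℂ : ℂ ≃L[ℝ] ℂ) : ℂ →L[ℝ] ℂ) Set.univ (1 / 2) := by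
    intro x _ y _
    have : x + f x - (y + f y) - (x - y) = f x - f y := by ring
    simpa [this] using hf x y
  have hN : Subsingleton ℂ ∨ (1 / 2 : NNReal) <
      ‖((ContinuousLinearEquiv.refl ℝ ℂ).symm : ℂ →L[ℝ] ℂ)‖₊⁻¹ := by
    right
    have : ‖((ContinuousLinearEquiv.refl ℝ ℂ).symm : ℂ →L[ℝ] ℂ)‖₊ = 1 := by
      change ‖ContinuousLinearMap.id ℝ ℂ‖₊ = 1
      exact ContinuousLinearMap.nnnorm_id
    rw [this, inv_one]
    exact NNReal.half_lt_self one_ne_zero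
  exact ⟨Set.injOn_univ.mp (key.injOn hN), key.surjective hN⟩

/-- A small displacement of the strands of a closed braid is an ambient isotopy: each strand drags
along a disc of radius `δ` around it, with a weight that decreases linearly to `0`. The weights are
`1 / δ`-Lipschitz, so that the total displacement of the plane is a contraction. -/
theorem IsBraid.ambientIsotopic_of_near {s r : ℕ} {z z' : ℕ → ℝ → ℂ} (hz : IsBraid s r z)
    (hz' : IsBraid s r z') {δ : ℝ} (hδ : 0 < δ)
    (hsep : ∀ j < s, ∀ k < s, j ≠ k → ∀ h, δ ≤ ‖z j h - z k h‖)
    (hbd : ∀ j < s, ∀ h, ‖z j h‖ ≤ 1 - δ)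
    (hnear : ∀ j < s, ∀ h, ‖z' j h - z j h‖ * (2 * s) ≤ δ) :
    AmbientIsotopic (closedBraid s z) (closedBraid s z') := by
  let β : ℝ → ℝ := fun x => max 0 (1 - x / δ)
  have hβ : ∀ x y, |β x - β y| ≤ |x - y| / δ := by
    intro x y
    have h1 := abs_max_sub_max_le_abs (1 - x / δ) (1 - y / δ) 0
    have h2 : (1 - x / δ) - (1 - y / δ) = -((x - y) / δ) := by ring
    rw [h2, abs_neg, abs_div, abs_of_pos hδ] at h1
    simpa only [β, max_comm (0 : ℝ)] using h1
  have hβ0 : ∀ x, δ ≤ x → β x = 0 := by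
    intro x hx
    exact max_eq_left (by rw [sub_nonpos, le_div_iff₀ hδ]; linarith)
  let D : unitInterval → ℝ → ℂ → ℂ := fun τ h w =>
    ∑ j ∈ Finset.range s, ((τ * β ‖w - z j h‖ : ℝ) : ℂ) * (z' j h - z j h)
  have hcz := hz.continuous
  have hcz' := hz'.continuous
  have hk : ∀ k < s, ∀ h, z k h + D 1 h (z k h) = z' k h := by
    intro k hk h
    have : D 1 h (z k h) = z' k h - z k h := by
      simp only [D]
      rw [Finset.sum_eq_single_of_mem k (Finset.mem_range.mpr hk)]
      · simp [β]
      · intro j hj hjk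
        rw [hβ0 _ (hsep k hk j (Finset.mem_range.mp hj) hjk.symm h)]
        simp
    rw [this]; ring
  have := ambientIsotopic_of_fibrewise s (fun τ h w => w + D τ h w) ?_ ?_ ?_ ?_ ?_
    (z := z) (fun j hj h => (hbd j hj h).trans (by linarith))
  · have e : closedBraid s (fun j h => z j h + D 1 h (z j h)) = closedBraid s z' := by
      ext x
      constructor
      · rintro ⟨j, hj, h, hh, e⟩
        exact ⟨j, hj, h, hh, e.trans (congrArg (discCoord · h) (hk j hj h))⟩
      · rintro ⟨j, hj, h, hh, e⟩
        exact ⟨j, hj, h, hh, e.trans (congrArg (discCoord · h) (hk j hj h).symm)⟩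
    rwa [e] at this
  · have hβc : Continuous β := by fun_prop
    refine Continuous.add (by fun_prop) (continuous_finsetSum _ fun j _ => ?_)
    have := hcz j
    have := hcz' j
    fun_prop
  · intro τ h
    funext w
    simp only [D, hz.add_turn, hz'.add_turn]
    congr 1
    exact sum_range_add_of_periodic
      (g := fun j => ((τ * β ‖w - z j h‖ : ℝ) : ℂ) * (z' j h - z j h))
      (fun j => by rw [hz.add_strands, hz'.add_strands]) r
  · intro τ h
    refine bijective_add_of_lipschitz_half fun x y => ?_
    simp only [D, ← Finset.sum_sub_distrib, ← sub_mul]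
    have hterm : ∀ j ∈ Finset.range s,
        ‖(((τ * β ‖x - z j h‖ : ℝ) : ℂ) - ((τ * β ‖y - z j h‖ : ℝ) : ℂ)) * (z' j h - z j h)‖ * s
          ≤ 1 / 2 * ‖x - y‖ := by
      intro j hj
      have hs : 0 ≤ (s : ℝ) := s.cast_nonneg
      rw [norm_mul, ← Complex.ofReal_sub, Complex.norm_real, ← mul_sub, Real.norm_eq_abs, abs_mul,
        abs_of_nonneg τ.2.1]
      have h1 : (τ : ℝ) * |β ‖x - z j h‖ - β ‖y - z j h‖| ≤ ‖x - y‖ / δ := by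
        have h2 := hβ ‖x - z j h‖ ‖y - z j h‖
        have h3 : |‖x - z j h‖ - ‖y - z j h‖| ≤ ‖x - y‖ := by
          have := abs_norm_sub_norm_le (x - z j h) (y - z j h)
          rwa [sub_sub_sub_cancel_right] at this
        have h4 : |‖x - z j h‖ - ‖y - z j h‖| / δ ≤ ‖x - y‖ / δ := by gcongr
        calc _ ≤ 1 * |β ‖x - z j h‖ - β ‖y - z j h‖| := by gcongr; exact τ.2.2
          _ ≤ _ := by linarith
      have h5 : ‖z' j h - z j h‖ * s ≤ δ / 2 := by
        have := hnear j (Finset.mem_range.mp hj) h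
        linarith
      calc _ ≤ ‖x - y‖ / δ * ‖z' j h - z j h‖ * s := by gcongr
        _ = ‖x - y‖ / δ * (‖z' j h - z j h‖ * s) := by ring
        _ ≤ ‖x - y‖ / δ * (δ / 2) := by gcongr
        _ = _ := by field_simp
    rcases Nat.eq_zero_or_pos s with hs | hs
    · simp [hs]
    · have hs' : (0 : ℝ) < s := by exact_mod_cast hs
      calc _ ≤ ∑ j ∈ Finset.range s, (1 / 2 * ‖x - y‖) / s :=
            norm_sum_le_of_le _ fun j hj => by rw [le_div_iff₀ hs']; exact hterm j hj
        _ = _ := by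
            rw [Finset.sum_const, Finset.card_range, nsmul_eq_mul]
            field_simp
  · intro τ h u hu
    have : D τ h u = 0 := by
      refine Finset.sum_eq_zero fun j hj => ?_
      have h1 := hbd j (Finset.mem_range.mp hj) h
      have h2 := norm_sub_norm_le u (z j h)
      rw [hβ0 _ (by linarith)]
      simp
    simp [this]
  · intro h u
    simp [D]

/-! ### Continuous families of closed braids -/

/-- A parameter that has period `T` ranges over a compact set, so that local uniformity in it is
global. -/
theorem eventually_forall_of_periodic {Y : Type*} [TopologicalSpace Y] {T : ℝ} (hT : 0 < T)
    {P : ℝ → Y → Prop} (hP : ∀ h y, P (h + T) y ↔ P h y) {y₀ : Y}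
    (H : ∀ h, ∀ᶠ p : ℝ × Y in 𝓝 (h, y₀), P p.1 p.2) : ∀ᶠ y in 𝓝 y₀, ∀ h, P h y := by
  have h1 : ∀ᶠ y in 𝓝 y₀, ∀ h ∈ Set.Icc 0 T, P h y := by
    refine isCompact_Icc.eventually_forall_of_forall_eventually fun h _ => ?_
    exact (continuous_swap.tendsto (y₀, h)).eventually (H h)
  filter_upwards [h1] with y hy h
  have hper : Function.Periodic (fun h => P h y) T := fun h => propext (hP h y)
  obtain ⟨h', hh', e⟩ := hper.exists_mem_Ico₀ hT h
  exact e.mpr (hy h' ⟨hh'.1, hh'.2.le⟩)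

theorem exists_pos_le_of_periodic {T : ℝ} (hT : 0 < T) {f : ℝ → ℝ} (hf : Continuous f)
    (hper : ∀ h, f (h + T) = f h) (hpos : ∀ h, 0 < f h) : ∃ c > 0, ∀ h, c ≤ f h := by
  obtain ⟨h₀, -, hmin⟩ := isCompact_Icc.exists_isMinOn (Set.nonempty_Icc.mpr hT.le)
    hf.continuousOn
  refine ⟨f h₀, hpos h₀, fun h => ?_⟩
  obtain ⟨h', hh', e⟩ := Function.Periodic.exists_mem_Ico₀ (f := f) hper hT h
  rw [e]
  exact hmin ⟨hh'.1, hh'.2.le⟩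

theorem IsBraid.add_mul_strands {s r : ℕ} {z : ℕ → ℝ → ℂ} (hz : IsBraid s r z) (j n : ℕ) :
    z (j + n * s) = z j := by
  induction n with
  | zero => simp
  | succ n ih => rw [add_one_mul, ← add_assoc, hz.add_strands, ih]

/-- Every single strand closes up after `s` turns. -/
theorem IsBraid.periodic {s r : ℕ} {z : ℕ → ℝ → ℂ} (hz : IsBraid s r z) (j : ℕ) (h : ℝ) :
    z j (h + s * (2 * Real.pi)) = z j h := by
  have : ∀ n : ℕ, z j (h + n * (2 * Real.pi)) = z (j + n * r) h := by
    intro n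
    induction n generalizing j with
    | zero => simp
    | succ n ih =>
      have e : h + (n + 1 : ℕ) * (2 * Real.pi) = h + n * (2 * Real.pi) + 2 * Real.pi := by
        push_cast; ring
      rw [e, hz.add_turn, ih]
      congr 1; ring
  rw [this, mul_comm s r, hz.add_mul_strands]

theorem IsBraid.exists_separation {s r : ℕ} {z : ℕ → ℝ → ℂ} (hz : IsBraid s r z)
    (hs : 0 < s) (hne : ∀ j < s, ∀ k < s, j ≠ k → ∀ h, z j h ≠ z k h) :
    ∃ δ > 0, ∀ j < s, ∀ k < s, j ≠ k → ∀ h, δ ≤ ‖z j h - z k h‖ := by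
  have hT : (0 : ℝ) < s * (2 * Real.pi) := by positivity
  have h1 : ∀ᶠ δ : ℝ in 𝓝[>] 0, ∀ j ∈ Finset.range s, ∀ k ∈ Finset.range s, j ≠ k →
      ∀ h, δ ≤ ‖z j h - z k h‖ := by
    rw [Filter.eventually_all_finset]
    intro j hj
    rw [Filter.eventually_all_finset]
    intro k hk
    by_cases hjk : j = k
    · exact .of_forall fun _ h => absurd hjk h
    obtain ⟨c, hc, hc'⟩ := exists_pos_le_of_periodic hT
      ((hz.continuous j).sub (hz.continuous k)).norm
      (fun h => by simp only [Pi.sub_apply, hz.periodic])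
      (fun h => norm_pos_iff.mpr (sub_ne_zero.mpr
        (hne j (Finset.mem_range.mp hj) k (Finset.mem_range.mp hk) hjk h)))
    filter_upwards [Ioo_mem_nhdsGT hc] with δ hδ _ h
    exact hδ.2.le.trans (hc' h)
  obtain ⟨δ, h2, h3⟩ := (h1.and self_mem_nhdsWithin).exists
  exact ⟨δ, h3, fun j hj k hk => h2 j (Finset.mem_range.mpr hj) k (Finset.mem_range.mpr hk)⟩

theorem IsBraid.exists_boundary_distance {s r : ℕ} {z : ℕ → ℝ → ℂ} (hz : IsBraid s r z)
    (hs : 0 < s) (hlt : ∀ j < s, ∀ h, ‖z j h‖ < 1) :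
    ∃ δ > 0, ∀ j < s, ∀ h, ‖z j h‖ ≤ 1 - δ := by
  have hT : (0 : ℝ) < s * (2 * Real.pi) := by positivity
  have h1 : ∀ᶠ δ : ℝ in 𝓝[>] 0, ∀ j ∈ Finset.range s, ∀ h, ‖z j h‖ ≤ 1 - δ := by
    rw [Filter.eventually_all_finset]
    intro j hj
    obtain ⟨c, hc, hc'⟩ := exists_pos_le_of_periodic hT
      (f := fun h => 1 - ‖z j h‖) (continuous_const.sub (hz.continuous j).norm)
      (fun h => by simp only [hz.periodic])
      (fun h => sub_pos.mpr (hlt j (Finset.mem_range.mp hj) h))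
    filter_upwards [Ioo_mem_nhdsGT hc] with δ hδ h
    linarith [hc' h, hδ.2]
  obtain ⟨δ, h2, h3⟩ := (h1.and self_mem_nhdsWithin).exists
  exact ⟨δ, h3, fun j hj => h2 j (Finset.mem_range.mpr hj)⟩

/-- Isotopy extension for closed braids: in a connected family of closed braids in the open disc,
all members are ambient isotopic. -/
theorem ambientIsotopic_of_preconnected {s r : ℕ} (hs : 0 < s) {P : Type*} [TopologicalSpace P]
    {A : Set P} (hA : IsPreconnected A) {Z : P → ℕ → ℝ → ℂ}
    (hc : ∀ j, Continuous fun q : P × ℝ => Z q.1 j q.2)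
    (hZ : ∀ p ∈ A, IsBraid s r (Z p))
    (hne : ∀ p ∈ A, ∀ j < s, ∀ k < s, j ≠ k → ∀ h, Z p j h ≠ Z p k h)
    (hlt : ∀ p ∈ A, ∀ j < s, ∀ h, ‖Z p j h‖ < 1) {p p' : P} (hp : p ∈ A) (hp' : p' ∈ A) :
    AmbientIsotopic (closedBraid s (Z p)) (closedBraid s (Z p')) := by
  have hT : (0 : ℝ) < s * (2 * Real.pi) := by positivity
  refine hA.induction₂ (fun p p' => AmbientIsotopic (closedBraid s (Z p)) (closedBraid s (Z p')))
    ?_ (fun _ _ _ _ _ _ => AmbientIsotopic.trans) (fun _ _ _ _ => AmbientIsotopic.symm) hp hp'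
  intro x hx
  obtain ⟨δ₁, hδ₁, hsep⟩ := (hZ x hx).exists_separation hs (hne x hx)
  obtain ⟨δ₂, hδ₂, hbd⟩ := (hZ x hx).exists_boundary_distance hs (hlt x hx)
  have hδ : 0 < min δ₁ δ₂ := lt_min hδ₁ hδ₂
  have h1 : ∀ᶠ y in 𝓝[A] x, ∀ j ∈ Finset.range s, ∀ h,
      ‖Z y j h - Z x j h‖ * (2 * s) ≤ min δ₁ δ₂ := by
    rw [Filter.eventually_all_finset]
    intro j _
    -- outside `A` nothing is known about periodicity, hence the disjunction
    have h2 : ∀ᶠ y in 𝓝 x, ∀ h, y ∉ A ∨ ‖Z y j h - Z x j h‖ * (2 * s) ≤ min δ₁ δ₂ := by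
      refine eventually_forall_of_periodic hT (fun h y => ?_) (fun h => ?_)
      · by_cases hy : y ∈ A
        · simp only [(hZ y hy).periodic, (hZ x hx).periodic]
        · simp [hy]
      · have h3 : Continuous fun q : ℝ × P => ‖Z q.2 j q.1 - Z x j q.1‖ * (2 * s) := by
          have a1 := (hc j).comp
            (continuous_snd.prodMk continuous_fst : Continuous fun q : ℝ × P => (q.2, q.1))
          have a2 := (hc j).comp
            (continuous_const.prodMk continuous_fst : Continuous fun q : ℝ × P => (x, q.1))
          exact (a1.sub a2).norm.mul continuous_const
        have h4 := h3.tendsto (h, x)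
        simp only [sub_self, norm_zero, zero_mul] at h4
        filter_upwards [h4.eventually (gt_mem_nhds hδ)] with q hq
        exact Or.inr hq.le
    filter_upwards [h2.filter_mono nhdsWithin_le_nhds, self_mem_nhdsWithin] with y hy hyA h
    exact (hy h).resolve_left (not_not_intro hyA)
  filter_upwards [h1, self_mem_nhdsWithin] with y hy hyA
  exact (hZ x hx).ambientIsotopic_of_near (hZ y hyA) hδ
    (fun j hj k hk hjk h => (min_le_left _ _).trans (hsep j hj k hk hjk h))
    (fun j hj h => (hbd j hj h).trans (by linarith [min_le_right δ₁ δ₂]))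
    (fun j hj h => hy j (Finset.mem_range.mpr hj) h)

/-! ### The strands of the lemniscate braid -/

theorem strandX_add_strands {s : ℕ} (hs : 0 < s) (r : ℕ) (a : ℝ) (j : ℕ) :
    strandX s r a (j + s) = strandX s r a j := by
  funext h
  have hs' : (s : ℝ) ≠ 0 := by exact_mod_cast hs.ne'
  have e : (r * h + 2 * Real.pi * (j + s : ℕ)) / s
      = (r * h + 2 * Real.pi * j) / s + 2 * Real.pi := by
    push_cast; field_simp; ring
  rw [strandX, strandX, e, Real.cos_add_two_pi]

theorem strandY_add_strands {s : ℕ} (hs : 0 < s) (r l : ℕ) (b : ℝ) (j : ℕ) :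
    strandY s r l b (j + s) = strandY s r l b j := by
  funext h
  have hs' : (s : ℝ) ≠ 0 := by exact_mod_cast hs.ne'
  have e : l * ((r * h + 2 * Real.pi * (j + s : ℕ)) / s)
      = l * ((r * h + 2 * Real.pi * j) / s) + l * (2 * Real.pi) := by
    push_cast; field_simp; ring
  rw [strandY, strandY, e, Real.sin_add_nat_mul_two_pi]

theorem strandX_add_turn (s r : ℕ) (a : ℝ) (j : ℕ) (h : ℝ) :
    strandX s r a j (h + 2 * Real.pi) = strandX s r a (j + r) h := by
  simp only [strandX]
  congr 3
  push_cast; ring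

theorem strandY_add_turn (s r l : ℕ) (b : ℝ) (j : ℕ) (h : ℝ) :
    strandY s r l b j (h + 2 * Real.pi) = strandY s r l b (j + r) h := by
  simp only [strandY]
  congr 4
  push_cast; ring

@[fun_prop]
theorem continuous_strandX (s r j : ℕ) : Continuous fun p : ℝ × ℝ => strandX s r p.1 j p.2 := by
  unfold strandX
  fun_prop

@[fun_prop]
theorem continuous_strandY (s r l j : ℕ) :
    Continuous fun p : ℝ × ℝ => strandY s r l p.1 j p.2 := by
  unfold strandY
  fun_prop

/-- A braid stays a braid under a continuous change of the transverse coordinates. -/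
theorem isBraid_comp_strands {s : ℕ} (hs : 0 < s) (r l : ℕ) (a b : ℝ) {E : ℝ → ℝ → ℂ}
    (hE : Continuous fun p : ℝ × ℝ => E p.1 p.2) :
    IsBraid s r fun j h => E (strandX s r a j h) (strandY s r l b j h) where
  continuous j := hE.comp
    (((continuous_strandX s r j).comp (continuous_const.prodMk continuous_id)).prodMk
      ((continuous_strandY s r l j).comp (continuous_const.prodMk continuous_id)))
  add_strands j := by simp only [strandX_add_strands hs, strandY_add_strands hs]
  add_turn j h := by simp only [strandX_add_turn, strandY_add_turn]

theorem isBraid_strandZ {s : ℕ} (hs : 0 < s) (r l : ℕ) (a b : ℝ) :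
    IsBraid s r (strandZ s r l a b) :=
  isBraid_comp_strands hs r l a b (E := fun x y => x + y * Complex.I) (by fun_prop)

theorem abs_strandX_le (s r : ℕ) {a : ℝ} (ha : 0 < a) (j : ℕ) (h : ℝ) :
    |strandX s r a j h| ≤ a := by
  rw [strandX, abs_mul, abs_of_pos ha]
  exact mul_le_of_le_one_right ha.le (Real.abs_cos_le_one _)

/-- At every height the strands are distinct: if `cos α = cos β` and `sin (l α) = sin (l β)` then
`α ≡ β`, or `β ≡ - α` and `l α` is a multiple of `π`; in the second case `s` divides
`l (j - k)`. -/
theorem strand_injective {s r l : ℕ} (hs : 0 < s) (hl : 0 < l) (hcop : Nat.Coprime s l)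
    {a b : ℝ} (ha : 0 < a) (hb : 0 < b) {j k : ℕ} (hj : j < s) (hk : k < s) {h : ℝ}
    (hX : strandX s r a j h = strandX s r a k h)
    (hY : strandY s r l b j h = strandY s r l b k h) : j = k := by
  have hs' : (s : ℝ) ≠ 0 := by exact_mod_cast hs.ne'
  have hl' : (l : ℝ) ≠ 0 := by exact_mod_cast hl.ne'
  have hpi := Real.pi_ne_zero
  suffices hdvd : (s : ℤ) ∣ (k - j : ℤ) by
    have h1 : (k - j : ℤ) = 0 := Int.eq_zero_of_abs_lt_dvd hdvd (by rw [abs_lt]; omega)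
    omega
  have hc := mul_left_cancel₀ ha.ne' hX
  have hsin := mul_left_cancel₀ (div_pos hb (by positivity : (0 : ℝ) < l)).ne' hY
  set α := (r * h + 2 * Real.pi * j) / s with hα
  set β := (r * h + 2 * Real.pi * k) / s with hβ
  have hdiff : (β - α) * s = 2 * Real.pi * (k - j) := by
    rw [hα, hβ]; field_simp; ring
  obtain ⟨n, hn | hn⟩ := Real.cos_eq_cos_iff.mp hc
  · refine ⟨n, ?_⟩
    have : (2 * Real.pi) * ((k : ℝ) - j) = (2 * Real.pi) * (s * n) := by
      rw [← hdiff, hn]; ring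
    have := mul_left_cancel₀ (by positivity) this
    exact_mod_cast this
  · have h1 : Real.sin (l * β) = -Real.sin (l * α) := by
      have e : l * β = ((l * n : ℤ) : ℝ) * (2 * Real.pi) - l * α := by rw [hn]; push_cast; ring
      rw [e, Real.sin_int_mul_two_pi_sub]
    have h2 : Real.sin (l * α) = 0 := by linarith
    obtain ⟨m, hm⟩ := Real.sin_eq_zero_iff.mp h2
    have h3 : (2 * Real.pi) * (l * ((k : ℝ) - j)) = (2 * Real.pi) * (s * (l * n - m)) := by
      have e : (2 * Real.pi) * (l * ((k : ℝ) - j)) = l * ((β - α) * s) := by rw [hdiff]; ring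
      rw [e, hn]
      linear_combination (2 * (s : ℝ)) * hm
    have h4 := mul_left_cancel₀ (by positivity) h3
    have h5 : (l * (k - j) : ℤ) = s * (l * n - m) := by exact_mod_cast h4
    exact (Int.isCoprime_iff_gcd_eq_one.mpr (by simpa using hcop)).dvd_of_dvd_mul_left ⟨_, h5⟩

theorem strandZ_injective {s r l : ℕ} (hs : 0 < s) (hl : 0 < l) (hcop : Nat.Coprime s l)
    {a b : ℝ} (ha : 0 < a) (hb : 0 < b) {j k : ℕ} (hj : j < s) (hk : k < s) {h : ℝ}
    (hZ : strandZ s r l a b j h = strandZ s r l a b k h) : j = k := by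
  have h1 := congrArg Complex.re hZ
  have h2 := congrArg Complex.im hZ
  simp [strandZ] at h1 h2
  exact strand_injective hs hl hcop ha hb hj hk h1 h2

theorem strandX_smul (s r : ℕ) (t a : ℝ) (j : ℕ) (h : ℝ) :
    strandX s r (t * a) j h = t * strandX s r a j h := by
  simp only [strandX]; ring

theorem strandY_smul (s r l : ℕ) (t b : ℝ) (j : ℕ) (h : ℝ) :
    strandY s r l (t * b) j h = t * strandY s r l b j h := by
  simp only [strandY]; ring

theorem strandZ_smul (s r l : ℕ) (t a b : ℝ) (j : ℕ) (h : ℝ) :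
    strandZ s r l (t * a) (t * b) j h = t * strandZ s r l a b j h := by
  simp only [strandZ, strandX_smul, strandY_smul]; push_cast; ring

theorem exists_norm_strandZ_le (s r l : ℕ) (a b : ℝ) :
    ∃ C > 0, ∀ j h, ‖strandZ s r l a b j h‖ ≤ C := by
  refine ⟨|a| + |b / l| + 1, by positivity, fun j h => ?_⟩
  have h1 : ‖strandZ s r l a b j h‖ ≤ |strandX s r a j h| + |strandY s r l b j h| := by
    refine (norm_add_le _ _).trans (le_of_eq ?_)
    simp
  have h2 : |strandX s r a j h| ≤ |a| := by
    rw [strandX, abs_mul]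
    exact mul_le_of_le_one_right (abs_nonneg _) (Real.abs_cos_le_one _)
  have h3 : |strandY s r l b j h| ≤ |b / l| := by
    rw [strandY, abs_mul]
    exact mul_le_of_le_one_right (abs_nonneg _) (Real.abs_sin_le_one _)
  linarith

/-! ### The lemniscate link in disc coordinates -/

/-- The first complex coordinate, under inverse stereographic projection, of a point of `ℝ³` at
distance `x` from the vertical axis and at height `y`. It maps the half-plane `0 < x` onto the
open unit disc. -/
noncomputable def halfPlaneToDisc (x y : ℝ) : ℂ :=
  ⟨(x ^ 2 + y ^ 2 - 1) / (x ^ 2 + y ^ 2 + 1), 2 * y / (x ^ 2 + y ^ 2 + 1)⟩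

theorem continuous_halfPlaneToDisc : Continuous fun p : ℝ × ℝ => halfPlaneToDisc p.1 p.2 := by
  simp only [halfPlaneToDisc, Complex.mk_eq_add_mul_I]
  have h : ∀ p : ℝ × ℝ, p.1 ^ 2 + p.2 ^ 2 + 1 ≠ 0 := fun p => by positivity
  have h1 : Continuous fun p : ℝ × ℝ => (p.1 ^ 2 + p.2 ^ 2 - 1) / (p.1 ^ 2 + p.2 ^ 2 + 1) :=
    Continuous.div (by fun_prop) (by fun_prop) h
  have h2 : Continuous fun p : ℝ × ℝ => 2 * p.2 / (p.1 ^ 2 + p.2 ^ 2 + 1) :=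
    Continuous.div (by fun_prop) (by fun_prop) h
  fun_prop

theorem one_sub_norm_halfPlaneToDisc_sq (x y : ℝ) :
    1 - ‖halfPlaneToDisc x y‖ ^ 2 = (2 * x / (x ^ 2 + y ^ 2 + 1)) ^ 2 := by
  have : x ^ 2 + y ^ 2 + 1 ≠ 0 := by positivity
  rw [halfPlaneToDisc, ← Complex.normSq_eq_norm_sq, Complex.normSq_mk]
  field_simp
  ring

theorem norm_halfPlaneToDisc_lt_one {x : ℝ} (hx : 0 < x) (y : ℝ) : ‖halfPlaneToDisc x y‖ < 1 := by
  have h1 := one_sub_norm_halfPlaneToDisc_sq x y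
  have h2 : 0 < (2 * x / (x ^ 2 + y ^ 2 + 1)) ^ 2 := by positivity
  nlinarith [norm_nonneg (halfPlaneToDisc x y)]

theorem halfPlaneToDisc_injective {x x' y y' : ℝ} (hx : 0 < x) (hx' : 0 < x')
    (H : halfPlaneToDisc x y = halfPlaneToDisc x' y') : x = x' ∧ y = y' := by
  have h1 := congrArg Complex.re H
  have h2 := congrArg Complex.im H
  simp only [halfPlaneToDisc] at h1 h2
  have p1 : 0 < x ^ 2 + y ^ 2 + 1 := by positivity
  have p2 : 0 < x' ^ 2 + y' ^ 2 + 1 := by positivity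
  rw [div_eq_div_iff p1.ne' p2.ne'] at h1 h2
  have h3 : x ^ 2 + y ^ 2 = x' ^ 2 + y' ^ 2 := by linarith
  rw [h3] at h2
  have h4 : y = y' := by
    have := mul_right_cancel₀ p2.ne' h2
    linarith
  subst h4
  exact ⟨by
    have : x ^ 2 = x' ^ 2 := by linarith
    exact (sq_eq_sq₀ hx.le hx'.le).mp this, rfl⟩

/-- Near the point `(1, 0)`, which goes to the centre of the disc, the map is the identity to first
order. -/
theorem norm_halfPlaneToDisc_sub_le {x y : ℝ} (h : ‖(x + y * Complex.I : ℂ)‖ ≤ 1) :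
    ‖halfPlaneToDisc (1 + x) y - (x + y * Complex.I)‖ ≤ 4 * ‖(x + y * Complex.I : ℂ)‖ ^ 2 := by
  set z : ℂ := x + y * Complex.I with hz
  have hzn : ‖z‖ ^ 2 = x ^ 2 + y ^ 2 := by
    rw [← Complex.normSq_eq_norm_sq, hz, Complex.normSq_add_mul_I]
  set d : ℝ := (1 + x) ^ 2 + y ^ 2 + 1 with hd
  have hd1 : 1 ≤ d := by rw [hd]; nlinarith [sq_nonneg (1 + x), sq_nonneg y]
  have hd0 : (d : ℂ) ≠ 0 := by exact_mod_cast (by linarith : d ≠ 0)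
  have e : halfPlaneToDisc (1 + x) y - z =
      (((‖z‖ ^ 2 : ℝ) : ℂ) - z * ((2 * x + ‖z‖ ^ 2 : ℝ) : ℂ)) / d := by
    rw [eq_div_iff hd0, hzn]
    rw [halfPlaneToDisc, Complex.mk_eq_add_mul_I, ← hd]
    push_cast
    field_simp
    rw [hz, hd]
    push_cast
    ring
  have hx : |x| ≤ ‖z‖ := by
    have := Complex.abs_re_le_norm z
    simpa [hz] using this
  rw [e, norm_div, Complex.norm_real, Real.norm_of_nonneg (by linarith : 0 ≤ d)]
  refine (div_le_self (norm_nonneg _) hd1).trans ((norm_sub_le _ _).trans ?_)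
  rw [norm_mul, Complex.norm_real, Complex.norm_real, Real.norm_of_nonneg (by positivity),
    Real.norm_eq_abs]
  have h1 : |2 * x + ‖z‖ ^ 2| ≤ 2 * |x| + ‖z‖ ^ 2 := by
    refine (abs_add_le _ _).trans (le_of_eq ?_)
    rw [abs_mul, abs_two, abs_of_nonneg (by positivity : (0 : ℝ) ≤ ‖z‖ ^ 2)]
  have h2 : |2 * x + ‖z‖ ^ 2| ≤ 3 * ‖z‖ := by nlinarith [norm_nonneg z]
  nlinarith [norm_nonneg z, mul_le_mul_of_nonneg_left h2 (norm_nonneg z)]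

theorem invStereo_cylindrical {x : ℝ} (hx : 0 ≤ x) (y h : ℝ) :
    invStereo (Real.cos h * x, Real.sin h * x, y) = discCoord (halfPlaneToDisc x y) h := by
  have hpos : (0 : ℝ) < x ^ 2 + y ^ 2 + 1 := by positivity
  have hne : ((x : ℂ) ^ 2 + y ^ 2 + 1) ≠ 0 := by exact_mod_cast hpos.ne'
  have hρ : (Real.cos h * x) ^ 2 + (Real.sin h * x) ^ 2 + y ^ 2 = x ^ 2 + y ^ 2 := by
    linear_combination x ^ 2 * Real.cos_sq_add_sin_sq h
  simp only [invStereo, discCoord, hρ, one_sub_norm_halfPlaneToDisc_sq]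
  rw [Real.sqrt_sq (by positivity), halfPlaneToDisc, Complex.mk_eq_add_mul_I, Complex.exp_mul_I]
  push_cast
  ext1
  · field_simp
  · field_simp

/-- The strands of the lemniscate braid in disc coordinates. -/
noncomputable def discStrand (s r l : ℕ) (a b R : ℝ) (j : ℕ) (h : ℝ) : ℂ :=
  halfPlaneToDisc (R + strandX s r a j h) (strandY s r l b j h)

theorem radius_pos (s r : ℕ) {a R : ℝ} (ha : 0 < a) (hR : a < R) (j : ℕ) (h : ℝ) :
    0 < R + strandX s r a j h := by
  linarith [(abs_le.mp (abs_strandX_le s r ha j h)).1]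

theorem setOf_mem_invStereo_lemniscateLink (s r l : ℕ) {a R : ℝ} (b : ℝ) (ha : 0 < a)
    (hR : a < R) :
    {x : S3 | (x : ℂ × ℂ) ∈ invStereo '' lemniscateLink s r l a b R}
      = closedBraid s (discStrand s r l a b R) := by
  ext x
  constructor
  · rintro ⟨p, ⟨j, hj, h, hh, rfl⟩, e⟩
    exact ⟨j, hj, h, hh, by rw [← e, invStereo_cylindrical (radius_pos s r ha hR j h).le]; rfl⟩
  · rintro ⟨j, hj, h, hh, e⟩
    exact ⟨_, ⟨j, hj, h, hh, rfl⟩, by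
      rw [e, invStereo_cylindrical (radius_pos s r ha hR j h).le]; rfl⟩

theorem isBraid_discStrand {s : ℕ} (hs : 0 < s) (r l : ℕ) (a b R : ℝ) :
    IsBraid s r (discStrand s r l a b R) :=
  isBraid_comp_strands hs r l a b (E := fun x y => halfPlaneToDisc (R + x) y)
    (continuous_halfPlaneToDisc.comp (by fun_prop : Continuous fun p : ℝ × ℝ => (R + p.1, p.2)))

/-- The isotopy type of the lemniscate link depends neither on `a`, `b` nor on `R`. -/
theorem ambientIsotopic_discStrand {s r l : ℕ} (hs : 0 < s) (hl : 0 < l)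
    (hcop : Nat.Coprime s l) {a b R a' b' R' : ℝ} (ha : 0 < a) (hb : 0 < b) (hR : a < R)
    (ha' : 0 < a') (hb' : 0 < b') (hR' : a' < R') :
    AmbientIsotopic (closedBraid s (discStrand s r l a b R))
      (closedBraid s (discStrand s r l a' b' R')) := by
  let A : Set (ℝ × ℝ × ℝ) := {p | 0 < p.1 ∧ 0 < p.2.1 ∧ p.1 < p.2.2}
  have hA : IsPreconnected A := by
    refine Convex.isPreconnected ?_
    rintro ⟨x, y, w⟩ ⟨h1, h2, h3⟩ ⟨x', y', w'⟩ ⟨h1', h2', h3'⟩ c d hc hd hcd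
    simp only at h1 h2 h3 h1' h2' h3'
    have key : ∀ {u v : ℝ}, 0 < u → 0 < v → 0 < c * u + d * v := by
      intro u v hu hv
      rcases hc.eq_or_lt with rfl | hc
      · have : d = 1 := by linarith
        subst this; linarith
      · have := mul_pos hc hu
        have := mul_nonneg hd hv.le
        linarith
    refine ⟨key h1 h1', key h2 h2', ?_⟩
    have := key (sub_pos.mpr h3) (sub_pos.mpr h3')
    simp only [smul_eq_mul, Prod.smul_mk, Prod.mk_add_mk]
    linarith
  refine ambientIsotopic_of_preconnected hs hA (r := r)
    (Z := fun p => discStrand s r l p.1 p.2.1 p.2.2) (p := (a, b, R)) (p' := (a', b', R'))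
    ?_ ?_ ?_ ?_ ⟨ha, hb, hR⟩ ⟨ha', hb', hR'⟩
  · intro j
    refine continuous_halfPlaneToDisc.comp (Continuous.prodMk (Continuous.add (by fun_prop) ?_) ?_)
    · exact (continuous_strandX s r j).comp
        (by fun_prop : Continuous fun q : (ℝ × ℝ × ℝ) × ℝ => (q.1.1, q.2))
    · exact (continuous_strandY s r l j).comp
        (by fun_prop : Continuous fun q : (ℝ × ℝ × ℝ) × ℝ => (q.1.2.1, q.2))
  · exact fun p _ => isBraid_discStrand hs r l _ _ _
  · rintro ⟨a, b, R⟩ ⟨h1, h2, h3⟩ j hj k hk hjk h e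
    obtain ⟨e1, e2⟩ := halfPlaneToDisc_injective (radius_pos s r h1 h3 j h)
      (radius_pos s r h1 h3 k h) e
    exact hjk (strand_injective hs hl hcop h1 h2 hj hk (add_left_cancel e1) e2)
  · rintro ⟨a, b, R⟩ ⟨h1, h2, h3⟩ j hj h
    exact norm_halfPlaneToDisc_lt_one (radius_pos s r h1 h3 j h) _

/-! ### The semiholomorphic polynomial -/

theorem semiholEval_exp (c : (ℕ × ℤ) →₀ ℂ) (u : ℂ) (h : ℝ) :
    semiholEval c u (Complex.exp (h * Complex.I)) = trigEval c h u := by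
  refine Finset.sum_congr rfl fun m _ => ?_
  have hconj : conj (Complex.exp (h * Complex.I)) = (Complex.exp (h * Complex.I))⁻¹ := by
    rw [← Complex.exp_conj, ← Complex.exp_neg]
    simp
  have hne := Complex.exp_ne_zero (h * Complex.I)
  simp only
  congr 2
  rw [hconj, inv_pow, ← zpow_natCast, ← zpow_natCast, ← zpow_neg, ← zpow_add₀ hne]
  congr 1
  omega

theorem semiholPoly_exp (s r l : ℕ) (a b : ℝ) (u : ℂ) (h : ℝ) :
    semiholPoly s r l a b (u, Complex.exp (h * Complex.I)) = braidPoly s r l a b h u := by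
  rw [semiholPoly, semiholEval_exp, trigEval_braidCoeff]

theorem braidPoly_smul (s r l : ℕ) (t a b h : ℝ) (u : ℂ) :
    braidPoly s r l (t * a) (t * b) h (t * u) = t ^ s * braidPoly s r l a b h u := by
  simp only [braidPoly, strandZ_smul, ← mul_sub, Finset.prod_mul_distrib, Finset.prod_const,
    Finset.card_range]

/-- Scaling the braid by `t` scales the zeros in `u` of the polynomial by `t` and leaves `v`
alone. -/
theorem semiholPoly_smul (s r l : ℕ) {t : ℝ} (ht : t ≠ 0) (a b : ℝ) (x : ℂ × ℂ) :
    semiholPoly s r l (t * a) (t * b) x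
      = t ^ s * semiholPoly s r l a b ((t : ℂ)⁻¹ * x.1, x.2) := by
  have ht' : (t : ℂ) ≠ 0 := by exact_mod_cast ht
  set c := braidCoeff s r l a b with hc
  let c' : (ℕ × ℤ) →₀ ℂ := Finsupp.onFinset c.support
    (fun m => t ^ s * ((t : ℂ)⁻¹ ^ m.1 * c m)) (fun m hm => by
      rw [Finsupp.mem_support_iff]
      intro h0
      simp [h0] at hm)
  have hc' : braidCoeff s r l (t * a) (t * b) = c' := by
    refine trigEval_injective fun h u => ?_
    have e : trigEval c' h u = t ^ s * trigEval c h ((t : ℂ)⁻¹ * u) := by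
      rw [trigEval, Finsupp.onFinset_sum _ (by simp), trigEval, Finsupp.sum, Finset.mul_sum]
      refine Finset.sum_congr rfl fun m _ => ?_
      rw [mul_pow]; ring
    rw [e, trigEval_braidCoeff, hc, trigEval_braidCoeff, ← braidPoly_smul,
      mul_inv_cancel_left₀ ht']
  rw [semiholPoly, hc', semiholEval, Finsupp.onFinset_sum _ (by simp), semiholPoly, semiholEval,
    Finsupp.sum, Finset.mul_sum]
  refine Finset.sum_congr rfl fun m _ => ?_
  rw [mul_pow]; ring

/-- The polynomial is monic of degree `s` in `u`: its only monomial of degree at least `s` in `u`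
is `u ^ s`. -/
theorem braidCoeff_eq (s r l : ℕ) (a b : ℝ) :
    braidCoeff s r l a b
      = Finsupp.single (s, 0) 1 + (braidCoeff s r l a b).filter fun m => m.1 < s := by
  set c := braidCoeff s r l a b with hc
  refine trigEval_injective fun h u => ?_
  let e : ℂ := Complex.exp (h * Complex.I)
  -- the expression at a fixed `h`, as a polynomial in `u`
  let P : Polynomial ℂ := ∑ m ∈ c.support, Polynomial.monomial m.1 (c m * e ^ m.2)
  have hPeval : ∀ u, P.eval u = trigEval c h u := by
    intro u
    simp only [P, Polynomial.eval_finsetSum, Polynomial.eval_monomial, trigEval, Finsupp.sum]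
    refine Finset.sum_congr rfl fun m _ => ?_
    ring
  have hP : P = ∏ j ∈ Finset.range s, (Polynomial.X - Polynomial.C (strandZ s r l a b j h)) := by
    refine Polynomial.funext fun u => ?_
    rw [hPeval, hc, trigEval_braidCoeff, braidPoly, Polynomial.eval_prod]
    simp
  have hmonic : P.Monic := hP ▸ Polynomial.monic_prod_X_sub_C _ _
  have hdeg : P.natDegree = s := by
    rw [hP, Polynomial.natDegree_finsetProd_X_sub_C_eq_card, Finset.card_range]
  have hcoeff : ∀ k, P.coeff k = ∑ m ∈ c.support, if m.1 = k then c m * e ^ m.2 else 0 := by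
    intro k
    simp only [P, Polynomial.finsetSum_coeff, Polynomial.coeff_monomial]
  have hadd : trigEval (Finsupp.single (s, 0) 1 + c.filter fun m => m.1 < s) h u
      = u ^ s + ∑ m ∈ c.support, if m.1 < s then c m * (u ^ m.1 * e ^ m.2) else 0 := by
    rw [trigEval, Finsupp.sum_add_index' (by simp) (by intros; ring),
      Finsupp.sum_single_index (by simp), Finsupp.sum, Finsupp.support_filter,
      Finset.sum_filter]
    simp only [zpow_zero, mul_one, one_mul]
    congr 1
    refine Finset.sum_congr rfl fun m _ => ?_
    by_cases hm : m.1 < s <;> simp [hm, e]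
  rw [hadd, ← hPeval, hmonic.as_sum, hdeg]
  simp only [Polynomial.eval_add, Polynomial.eval_pow, Polynomial.eval_X,
    Polynomial.eval_finsetSum, Polynomial.eval_mul, Polynomial.eval_C, hcoeff, Finset.sum_mul]
  rw [Finset.sum_comm]
  congr 1
  refine Finset.sum_congr rfl fun m _ => ?_
  simp only [ite_mul, zero_mul, Finset.sum_ite_eq, Finset.mem_range]
  split_ifs <;> ring

/-- Cauchy's bound for the zeros in `u`, uniform in `v` on the closed unit disc. -/
theorem exists_bound_of_semiholPoly_eq_zero (s r l : ℕ) (a b : ℝ) :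
    ∃ C > 0, ∀ u v, ‖v‖ ≤ 1 → semiholPoly s r l a b (u, v) = 0 → ‖u‖ ≤ C := by
  set c := braidCoeff s r l a b with hc
  set d := c.filter fun m => m.1 < s with hd
  set A := ∑ m ∈ d.support, ‖d m‖ with hA
  have hA0 : 0 ≤ A := Finset.sum_nonneg fun _ _ => norm_nonneg _
  refine ⟨max 1 A, lt_max_of_lt_left one_pos, fun u v hv h0 => ?_⟩
  by_contra! hlt
  have hu1 : 1 < ‖u‖ := (le_max_left _ _).trans_lt hlt
  have huA : A < ‖u‖ := (le_max_right _ _).trans_lt hlt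
  have e : semiholPoly s r l a b (u, v) = u ^ s + semiholEval d u v := by
    rw [semiholPoly, ← hc, hc, braidCoeff_eq, ← hc, ← hd, semiholEval,
      Finsupp.sum_add_index' (by simp) (by intros; ring), Finsupp.sum_single_index (by simp)]
    simp [semiholEval]
  have hbound : ‖semiholEval d u v‖ * ‖u‖ ≤ A * ‖u‖ ^ s := by
    rw [hA, Finset.sum_mul]
    refine (mul_le_mul_of_nonneg_right (norm_sum_le _ _) (norm_nonneg u)).trans ?_
    rw [Finset.sum_mul]
    refine Finset.sum_le_sum fun m hm => ?_
    have hms : m.1 < s := by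
      rw [hd, Finsupp.support_filter, Finset.mem_filter] at hm
      exact hm.2
    rw [norm_mul, norm_mul, norm_mul, norm_pow, norm_pow, norm_pow, RCLike.norm_conj, mul_assoc]
    have h1 : ‖v‖ ^ m.2.toNat * ‖v‖ ^ (-m.2).toNat ≤ 1 :=
      mul_le_one₀ (pow_le_one₀ (norm_nonneg _) hv) (by positivity) (pow_le_one₀ (norm_nonneg _) hv)
    have h2 : ‖u‖ ^ m.1 * ‖u‖ ≤ ‖u‖ ^ s := by
      rw [← pow_succ]
      exact pow_le_pow_right₀ hu1.le hms
    gcongr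
    calc ‖u‖ ^ m.1 * (‖v‖ ^ m.2.toNat * ‖v‖ ^ (-m.2).toNat) * ‖u‖
        = (‖u‖ ^ m.1 * ‖u‖) * (‖v‖ ^ m.2.toNat * ‖v‖ ^ (-m.2).toNat) := by ring
      _ ≤ ‖u‖ ^ s * 1 := by gcongr
      _ = ‖u‖ ^ s := mul_one _
  have hnorm : ‖semiholEval d u v‖ = ‖u‖ ^ s := by
    rw [e] at h0
    rw [← norm_pow, ← norm_neg (u ^ s)]
    congr 1
    linear_combination h0
  rw [hnorm, mul_comm] at hbound
  have hpos : 0 < ‖u‖ ^ s := by positivity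
  exact huA.not_ge (le_of_mul_le_mul_right hbound hpos)

theorem contDiff_semiholPoly (s r l : ℕ) (a b : ℝ) : ContDiff ℝ 1 (semiholPoly s r l a b) := by
  have hconj : ContDiff ℝ 1 fun x : ℂ × ℂ => conj x.2 :=
    Complex.conjCLE.contDiff.comp contDiff_snd
  have : semiholPoly s r l a b = fun x => ∑ m ∈ (braidCoeff s r l a b).support,
      braidCoeff s r l a b m * (x.1 ^ m.1 * (x.2 ^ m.2.toNat * conj x.2 ^ (-m.2).toNat)) := rfl
  rw [this]
  refine ContDiff.sum fun m _ => contDiff_const.mul ((contDiff_fst.pow _).mul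
    ((contDiff_snd.pow _).mul (hconj.pow _)))

/-! ### Roots of perturbed functions -/

section Root

variable {F : ℂ → ℂ} {F' : ℂ → ℂ →L[ℝ] ℂ} {z m : ℂ} {c κ : ℝ}

theorem norm_image_sub_sub_mul_le
    (hF : ∀ w ∈ Metric.closedBall z κ, HasFDerivAt F (F' w) w)
    (hF' : ∀ w ∈ Metric.closedBall z κ, ‖F' w - ContinuousLinearMap.mul ℝ ℂ m‖ ≤ c / 2)
    {x y : ℂ} (hx : x ∈ Metric.closedBall z κ) (hy : y ∈ Metric.closedBall z κ) :
    ‖F x - F y - m * (x - y)‖ ≤ c / 2 * ‖x - y‖ :=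
  (convex_closedBall z κ).norm_image_sub_le_of_norm_hasFDerivWithin_le'
    (fun w hw => (hF w hw).hasFDerivWithinAt) hF' hy hx

/-- A function whose derivative is close to the multiplication by `m` is injective, with a linear
lower bound. -/
theorem mul_norm_sub_le_norm_image_sub (hm : c ≤ ‖m‖)
    (hF : ∀ w ∈ Metric.closedBall z κ, HasFDerivAt F (F' w) w)
    (hF' : ∀ w ∈ Metric.closedBall z κ, ‖F' w - ContinuousLinearMap.mul ℝ ℂ m‖ ≤ c / 2)
    {x y : ℂ} (hx : x ∈ Metric.closedBall z κ) (hy : y ∈ Metric.closedBall z κ) :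
    c / 2 * ‖x - y‖ ≤ ‖F x - F y‖ := by
  have h1 := norm_image_sub_sub_mul_le hF hF' hx hy
  have h2 := norm_sub_norm_le (m * (x - y)) (m * (x - y) - (F x - F y))
  rw [sub_sub_cancel, norm_sub_rev (m * (x - y)), norm_mul] at h2
  have h3 : c * ‖x - y‖ ≤ ‖m‖ * ‖x - y‖ := by gcongr
  linarith

/-- The simplified Newton iteration `w ↦ w - F w / m` is a contraction. -/
theorem exists_root (hc : 0 < c) (hκ : 0 < κ) (hm : c ≤ ‖m‖)
    (hF : ∀ w ∈ Metric.closedBall z κ, HasFDerivAt F (F' w) w)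
    (hF' : ∀ w ∈ Metric.closedBall z κ, ‖F' w - ContinuousLinearMap.mul ℝ ℂ m‖ ≤ c / 2)
    (hz : ‖F z‖ ≤ c * κ / 4) : ∃ w, ‖w - z‖ ≤ κ / 2 ∧ F w = 0 := by
  have hm0 : m ≠ 0 := norm_pos_iff.mp (hc.trans_le hm)
  let T : ℂ → ℂ := fun w => w - F w / m
  have hsub : Metric.closedBall z (κ / 2) ⊆ Metric.closedBall z κ :=
    Metric.closedBall_subset_closedBall (by linarith)
  have hz0 : z ∈ Metric.closedBall z (κ / 2) := Metric.mem_closedBall_self (by linarith)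
  have hT : ∀ x ∈ Metric.closedBall z (κ / 2), ∀ y ∈ Metric.closedBall z (κ / 2),
      ‖T x - T y‖ ≤ 1 / 2 * ‖x - y‖ := by
    intro x hx y hy
    have e : T x - T y = -(F x - F y - m * (x - y)) / m := by
      simp only [T]; field_simp; ring
    rw [e, norm_div, norm_neg, div_le_iff₀ (norm_pos_iff.mpr hm0)]
    have h1 := norm_image_sub_sub_mul_le hF hF' (hsub hx) (hsub hy)
    nlinarith [norm_nonneg (x - y), mul_le_mul_of_nonneg_right hm (norm_nonneg (x - y))]
  have hTz : ‖T z - z‖ ≤ κ / 4 := by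
    have e : T z - z = -(F z / m) := by simp only [T]; ring
    rw [e, norm_neg, norm_div, div_le_iff₀ (norm_pos_iff.mpr hm0)]
    nlinarith
  have hmaps : Set.MapsTo T (Metric.closedBall z (κ / 2)) (Metric.closedBall z (κ / 2)) := by
    intro x hx
    have h1 := hT x hx z hz0
    rw [mem_closedBall_iff_norm] at hx ⊢
    have h2 := norm_add_le (T x - T z) (T z - z)
    rw [sub_add_sub_cancel] at h2
    linarith
  have hcontr : ContractingWith (1 / 2) (hmaps.restrict T _ _) := by
    refine ⟨NNReal.half_lt_self one_ne_zero, LipschitzWith.of_dist_le_mul fun x y => ?_⟩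
    simpa [Subtype.dist_eq, dist_eq_norm] using hT x x.2 y y.2
  obtain ⟨w, hw, hfix, -⟩ := hcontr.exists_fixedPoint'
    Metric.isClosed_closedBall.isComplete hmaps hz0 (edist_ne_top _ _)
  refine ⟨w, mem_closedBall_iff_norm.mp hw, ?_⟩
  have h1 : F w / m = 0 := by
    have : w - F w / m = w := hfix
    linear_combination -this
  exact (div_eq_zero_iff.mp h1).resolve_right hm0

theorem surjective_of_norm_sub_mul_le {L : ℂ →L[ℝ] ℂ} (hc : 0 < c) (hm : c ≤ ‖m‖)
    (hL : ‖L - ContinuousLinearMap.mul ℝ ℂ m‖ ≤ c / 2) : Function.Surjective L := by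
  refine (LinearMap.injective_iff_surjective (f := (L : ℂ →ₗ[ℝ] ℂ))).mp ?_
  refine (injective_iff_map_eq_zero _).mpr fun η hη => ?_
  have hη' : L η = 0 := hη
  have h1 := ContinuousLinearMap.le_of_opNorm_le _ hL η
  simp only [sub_apply, hη', zero_sub, norm_neg,
    ContinuousLinearMap.mul_apply', norm_mul] at h1
  have h2 : c * ‖η‖ ≤ ‖m‖ * ‖η‖ := by gcongr
  have h3 : ‖η‖ ≤ 0 := by nlinarith
  exact norm_le_zero_iff.mp h3

end Root

/-! ### The polynomial on the three-sphere in rescaled disc coordinates -/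

/-- The coordinate `v` of the point of the three-sphere with `u = t w` and argument of `v` given
by the unit complex number `e`. -/
noncomputable def sphereV (t : ℝ) (e w : ℂ) : ℂ := (Real.sqrt (1 - t ^ 2 * ‖w‖ ^ 2) : ℂ) * e

/-- The derivative of `sphereV t e` at `w`. -/
noncomputable def sphereVDeriv (t : ℝ) (e w : ℂ) : ℂ →L[ℝ] ℂ :=
  (-(t ^ 2 / Real.sqrt (1 - t ^ 2 * ‖w‖ ^ 2))) •
    ContinuousLinearMap.smulRightL ℝ ℂ ℂ (innerSL ℝ w) e

theorem sphereVDeriv_apply (t : ℝ) (e w η : ℂ) :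
    sphereVDeriv t e w η =
      ((-(t ^ 2 / Real.sqrt (1 - t ^ 2 * ‖w‖ ^ 2)) * (conj w * η).re : ℝ) : ℂ) * e := by
  simp only [sphereVDeriv, smul_apply, ContinuousLinearMap.smulRightL_apply_apply,
    ContinuousLinearMap.smulRight_apply, innerSL_apply_apply, Complex.inner, Complex.real_smul]
  push_cast
  ring_nf

theorem hasFDerivAt_sphereV {t : ℝ} (e : ℂ) {w : ℂ} (hw : t ^ 2 * ‖w‖ ^ 2 < 1) :
    HasFDerivAt (sphereV t e) (sphereVDeriv t e w) w := by
  have h0 : 1 - t ^ 2 * ‖w‖ ^ 2 ≠ 0 := by linarith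
  have h1 : HasFDerivAt (fun w : ℂ => ‖w‖ ^ 2) (2 • innerSL ℝ w) w :=
    (hasStrictFDerivAt_norm_sq w).hasFDerivAt
  have h2 := ((h1.const_mul (t ^ 2)).const_sub 1).sqrt h0
  have h3 := h2.smul_const e
  have e1 : (fun y : ℂ => Real.sqrt (1 - t ^ 2 * ‖y‖ ^ 2) • e) = sphereV t e := by
    funext y
    rw [Complex.real_smul, sphereV]
  rw [e1] at h3
  refine h3.congr_fderiv ?_
  ext1 η
  have h4 : Real.sqrt (1 - t ^ 2 * ‖w‖ ^ 2) ≠ 0 := (Real.sqrt_pos.mpr (by linarith)).ne'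
  rw [sphereVDeriv_apply]
  simp only [ContinuousLinearMap.smulRight_apply, smul_apply, neg_apply,
    innerSL_apply_apply, Complex.inner, Complex.real_smul, smul_eq_mul, nsmul_eq_mul]
  congr 2
  rw [mul_comm η]
  push_cast
  field_simp

section

variable (s r l : ℕ) (a b : ℝ)

/-- The polynomial restricted to the three-sphere, on the slice on which `v` has argument given by
`e`, as a function of `w = u / t`. For `t = 0` it is the braid polynomial. -/
noncomputable def slicePoly (t : ℝ) (e w : ℂ) : ℂ := semiholPoly s r l a b (w, sphereV t e w)

/-- The real derivative of `slicePoly s r l a b t e` at `w`; only meaningful for `t |w| < 1`. -/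
noncomputable def slicePolyDeriv (t : ℝ) (e w : ℂ) : ℂ →L[ℝ] ℂ :=
  (fderiv ℝ (semiholPoly s r l a b) (w, sphereV t e w)).comp
    (ContinuousLinearMap.inl ℝ ℂ ℂ + (ContinuousLinearMap.inr ℝ ℂ ℂ).comp (sphereVDeriv t e w))

theorem slicePolyDeriv_apply (t : ℝ) (e w η : ℂ) :
    slicePolyDeriv s r l a b t e w η
      = fderiv ℝ (semiholPoly s r l a b) (w, sphereV t e w) (η, sphereVDeriv t e w η) := by
  simp [slicePolyDeriv, ← map_add]

/-- The partial derivative in `u` of the polynomial at `(w, e)`, which is the derivative of the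
braid polynomial when `e` is a unit complex number. -/
noncomputable def partialU (e w : ℂ) : ℂ := fderiv ℝ (semiholPoly s r l a b) (w, e) (1, 0)

theorem hasFDerivAt_semiholPoly (x : ℂ × ℂ) :
    HasFDerivAt (semiholPoly s r l a b) (fderiv ℝ (semiholPoly s r l a b) x) x :=
  ((contDiff_semiholPoly s r l a b).differentiable one_ne_zero x).hasFDerivAt

theorem continuous_fderiv_semiholPoly : Continuous (fderiv ℝ (semiholPoly s r l a b)) :=
  (contDiff_semiholPoly s r l a b).continuous_fderiv one_ne_zero

theorem hasFDerivAt_slicePoly {t : ℝ} (e : ℂ) {w : ℂ} (hw : t ^ 2 * ‖w‖ ^ 2 < 1) :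
    HasFDerivAt (slicePoly s r l a b t e) (slicePolyDeriv s r l a b t e w) w := by
  have h1 := (hasFDerivAt_id (𝕜 := ℝ) w).prodMk (hasFDerivAt_sphereV e hw)
  refine ((hasFDerivAt_semiholPoly s r l a b (w, sphereV t e w)).comp w h1).congr_fderiv ?_
  ext1 η
  rw [slicePolyDeriv_apply]
  rfl

theorem continuous_sphereV : Continuous fun p : ℝ × ℂ × ℂ => sphereV p.1 p.2.1 p.2.2 := by
  unfold sphereV
  fun_prop

theorem continuous_slicePoly :
    Continuous fun p : ℝ × ℂ × ℂ => slicePoly s r l a b p.1 p.2.1 p.2.2 :=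
  (contDiff_semiholPoly s r l a b).continuous.comp
    ((continuous_snd.comp continuous_snd).prodMk continuous_sphereV)

theorem continuous_partialU : Continuous fun p : ℂ × ℂ => partialU s r l a b p.1 p.2 := by
  have := continuous_fderiv_semiholPoly s r l a b
  unfold partialU
  fun_prop

theorem continuousAt_slicePolyDeriv (e w : ℂ) :
    ContinuousAt (fun p : ℝ × ℂ × ℂ => slicePolyDeriv s r l a b p.1 p.2.1 p.2.2) (0, e, w) := by
  have h1 : Continuous fun p : ℝ × ℂ × ℂ =>
      fderiv ℝ (semiholPoly s r l a b) (p.2.2, sphereV p.1 p.2.1 p.2.2) :=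
    (continuous_fderiv_semiholPoly s r l a b).comp
      ((continuous_snd.comp continuous_snd).prodMk continuous_sphereV)
  have h2 : ContinuousAt (fun p : ℝ × ℂ × ℂ => sphereVDeriv p.1 p.2.1 p.2.2) (0, e, w) := by
    unfold sphereVDeriv
    have h3 : ContinuousAt (fun p : ℝ × ℂ × ℂ =>
        -(p.1 ^ 2 / Real.sqrt (1 - p.1 ^ 2 * ‖p.2.2‖ ^ 2))) (0, e, w) :=
      (ContinuousAt.div (by fun_prop) (by fun_prop) (by simp)).neg
    refine h3.smul (Continuous.continuousAt ?_)
    fun_prop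
  exact h1.continuousAt.clm_comp (continuousAt_const.add (continuousAt_const.clm_comp h2))

theorem slicePoly_zero (h : ℝ) (w : ℂ) :
    slicePoly s r l a b 0 (Complex.exp (h * Complex.I)) w = braidPoly s r l a b h w := by
  simp [slicePoly, sphereV, semiholPoly_exp]

/-- Where `v` is a unit complex number the polynomial is the braid polynomial, which is holomorphic
in `u`. -/
theorem fderiv_semiholPoly_inl (h : ℝ) (w η : ℂ) :
    fderiv ℝ (semiholPoly s r l a b) (w, Complex.exp (h * Complex.I)) (η, 0)
      = partialU s r l a b (Complex.exp (h * Complex.I)) w * η ∧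
    HasDerivAt (braidPoly s r l a b h) (partialU s r l a b (Complex.exp (h * Complex.I)) w) w := by
  set e := Complex.exp (h * Complex.I)
  have hd : DifferentiableAt ℂ (braidPoly s r l a b h) w := by
    unfold braidPoly
    fun_prop
  have h1 : HasFDerivAt (braidPoly s r l a b h)
      ((fderiv ℝ (semiholPoly s r l a b) (w, e)).comp (ContinuousLinearMap.inl ℝ ℂ ℂ)) w := by
    have h2 := (hasFDerivAt_semiholPoly s r l a b (w, e)).comp w
      (hasFDerivAt_prodMk_left (𝕜 := ℝ) w e)
    have e1 : (semiholPoly s r l a b ∘ fun w => (w, e)) = braidPoly s r l a b h :=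
      funext fun w => semiholPoly_exp s r l a b w h
    rwa [e1] at h2
  have h3 := h1.unique (hd.hasDerivAt.hasFDerivAt.restrictScalars ℝ)
  have h4 : ∀ η, fderiv ℝ (semiholPoly s r l a b) (w, e) (η, 0)
      = deriv (braidPoly s r l a b h) w * η := by
    intro η
    have := DFunLike.congr_fun h3 η
    simpa [mul_comm] using this
  have h5 : partialU s r l a b e w = deriv (braidPoly s r l a b h) w := by
    rw [partialU, h4, mul_one]
  rw [h5]
  exact ⟨h4 η, hd.hasDerivAt⟩

theorem slicePolyDeriv_zero (h : ℝ) (w : ℂ) :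
    slicePolyDeriv s r l a b 0 (Complex.exp (h * Complex.I)) w
      = ContinuousLinearMap.mul ℝ ℂ (partialU s r l a b (Complex.exp (h * Complex.I)) w) := by
  have h1 : sphereVDeriv 0 (Complex.exp (h * Complex.I)) w = 0 := by simp [sphereVDeriv]
  have h2 : sphereV 0 (Complex.exp (h * Complex.I)) w = Complex.exp (h * Complex.I) := by
    simp [sphereV]
  ext1 η
  rw [slicePolyDeriv, h1, h2]
  simpa using (fderiv_semiholPoly_inl s r l a b h w η).1

/-- At a root of the braid polynomial, the partial derivative in `u` is the product of the
differences with the other roots. -/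
theorem partialU_strandZ {j : ℕ} (hj : j < s) (h : ℝ) :
    partialU s r l a b (Complex.exp (h * Complex.I)) (strandZ s r l a b j h)
      = ∏ k ∈ (Finset.range s).erase j, (strandZ s r l a b j h - strandZ s r l a b k h) := by
  refine (fderiv_semiholPoly_inl s r l a b h _ 0).2.unique ?_
  have e : braidPoly s r l a b h = fun u => (u - strandZ s r l a b j h) *
      ∏ k ∈ (Finset.range s).erase j, (u - strandZ s r l a b k h) := by
    funext u
    exact (Finset.mul_prod_erase _ _ (Finset.mem_range.mpr hj)).symm
  rw [e]
  have h1 : DifferentiableAt ℂ (fun u => ∏ k ∈ (Finset.range s).erase j,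
      (u - strandZ s r l a b k h)) (strandZ s r l a b j h) := by fun_prop
  have h2 := ((hasDerivAt_id' (strandZ s r l a b j h)).sub_const (strandZ s r l a b j h)).mul
    h1.hasDerivAt
  refine h2.congr_deriv ?_
  simp

/-- On the three-sphere, the rescaled polynomial is a multiple of the slice polynomial. -/
theorem semiholPoly_discCoord {t : ℝ} (ht : t ≠ 0) (w : ℂ) (h : ℝ) :
    semiholPoly s r l (t * a) (t * b) (discCoord (t * w) h)
      = t ^ s * slicePoly s r l a b t (Complex.exp (h * Complex.I)) w := by
  have ht' : (t : ℂ) ≠ 0 := by exact_mod_cast ht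
  rw [semiholPoly_smul s r l ht, discCoord]
  simp only [inv_mul_cancel_left₀ ht', slicePoly, sphereV, norm_mul, mul_pow, Complex.norm_real,
    Real.norm_eq_abs, sq_abs]

/-- The curve `w ↦ (t w, sphereV t e w)` runs in the three-sphere, hence the derivative of the
polynomial on tangent vectors of the sphere has at least the range of the derivative of the slice
polynomial. -/
theorem isRegularPointOnS3_of_surjective {t : ℝ} (ht : t ≠ 0) {w : ℂ} {h : ℝ}
    (hw : t ^ 2 * ‖w‖ ^ 2 < 1)
    (hsurj : Function.Surjective (slicePolyDeriv s r l a b t (Complex.exp (h * Complex.I)) w)) :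
    IsRegularPointOnS3 (semiholPoly s r l (t * a) (t * b)) (discCoord (t * w) h) := by
  have ht' : (t : ℂ) ≠ 0 := by exact_mod_cast ht
  set e := Complex.exp (h * Complex.I) with he
  let M : ℂ × ℂ →L[ℝ] ℂ × ℂ :=
    ((ContinuousLinearMap.mul ℝ ℂ (t : ℂ)⁻¹).comp (ContinuousLinearMap.fst ℝ ℂ ℂ)).prod
      (ContinuousLinearMap.snd ℝ ℂ ℂ)
  have hx : discCoord (t * w) h = (t * w, sphereV t e w) := by
    simp only [discCoord, sphereV, norm_mul, mul_pow, Complex.norm_real, Real.norm_eq_abs, sq_abs,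
      ← he]
  have hMx : M (discCoord (t * w) h) = (w, sphereV t e w) := by
    rw [hx]
    simp [M, inv_mul_cancel_left₀ ht']
  have hfun : semiholPoly s r l (t * a) (t * b)
      = fun x => (t : ℂ) ^ s * (semiholPoly s r l a b ∘ M) x := by
    funext x
    rw [semiholPoly_smul s r l ht]
    rfl
  have hd : HasFDerivAt (semiholPoly s r l (t * a) (t * b))
      ((t : ℂ) ^ s • (fderiv ℝ (semiholPoly s r l a b) (w, sphereV t e w)).comp M)
      (discCoord (t * w) h) := by
    have h1 := (hasFDerivAt_semiholPoly s r l a b (M (discCoord (t * w) h))).comp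
      (discCoord (t * w) h) M.hasFDerivAt
    rw [hMx] at h1
    rw [hfun]
    exact h1.const_mul _
  refine ⟨hd.differentiableAt, fun y _ => ?_⟩
  obtain ⟨η, hη⟩ := hsurj (((t : ℂ) ^ s)⁻¹ * y)
  refine ⟨(t * η, sphereVDeriv t e w η), ?_, ?_⟩
  · have hρ : 0 < Real.sqrt (1 - t ^ 2 * ‖w‖ ^ 2) := Real.sqrt_pos.mpr (by linarith)
    have hee : conj e * e = 1 := by
      rw [he, ← Complex.normSq_eq_conj_mul_self, Complex.normSq_eq_norm_sq,
        Complex.norm_exp_ofReal_mul_I]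
      simp
    have e1 : conj (t * w) * (t * η) + conj (sphereV t e w) * sphereVDeriv t e w η
        = (t ^ 2 : ℝ) * (conj w * η) - ((t ^ 2 * (conj w * η).re : ℝ) : ℂ) := by
      rw [sphereVDeriv_apply, sphereV, map_mul, map_mul, Complex.conj_ofReal, Complex.conj_ofReal]
      set ρ := Real.sqrt (1 - t ^ 2 * ‖w‖ ^ 2)
      have hρ' : (ρ : ℂ) ≠ 0 := by exact_mod_cast hρ.ne'
      set q := (conj w * η).re
      push_cast
      have e2 : (ρ : ℂ) * conj e * (-(t ^ 2 / ρ) * q * e) = -(t ^ 2 * q) * (conj e * e) := by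
        field_simp
      rw [e2, hee]
      ring
    rw [hx]
    change (conj (t * w) * (t * η) + conj (sphereV t e w) * sphereVDeriv t e w η).re = 0
    rw [e1, Complex.sub_re, Complex.re_ofReal_mul, Complex.ofReal_re, sub_self]
  · rw [hd.fderiv]
    have e3 : fderiv ℝ (semiholPoly s r l a b) (w, sphereV t e w) (η, sphereVDeriv t e w η)
        = ((t : ℂ) ^ s)⁻¹ * y := by
      rw [← hη, slicePolyDeriv_apply]
    have e4 : M (t * η, sphereVDeriv t e w η) = (η, sphereVDeriv t e w η) := by
      simp [M, inv_mul_cancel_left₀ ht']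
    rw [smul_apply, ContinuousLinearMap.comp_apply, e4, e3, smul_eq_mul,
      mul_inv_cancel_left₀ (pow_ne_zero _ ht')]

end

theorem IsRegularPointOnS3.isRegularPoint {f : ℂ × ℂ → ℂ} {x : ℂ × ℂ}
    (h : IsRegularPointOnS3 f x) : IsRegularPoint f x :=
  ⟨h.1, fun y => by
    obtain ⟨ξ, -, hξ⟩ := h.2 (Set.mem_univ y)
    exact ⟨ξ, hξ⟩⟩

/-! ### The zeros of the polynomial on the three-sphere -/

theorem IsBraid.mod_strands {s r : ℕ} {z : ℕ → ℝ → ℂ} (hz : IsBraid s r z) (j : ℕ) :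
    z (j % s) = z j := by
  conv_rhs => rw [← Nat.mod_add_div j s, mul_comm, hz.add_mul_strands]

theorem exp_add_nat_mul_two_pi_mul_I (h : ℝ) (n : ℕ) :
    Complex.exp ((h + n * (2 * Real.pi) : ℝ) * Complex.I) = Complex.exp (h * Complex.I) := by
  rw [Complex.exp_eq_exp_iff_exists_int]
  exact ⟨n, by push_cast; ring⟩

section

variable {s l : ℕ} (r : ℕ) {a b : ℝ}

/-- The roots of the braid polynomial are uniformly simple. -/
theorem exists_le_norm_partialU (hs : 0 < s) (hl : 0 < l) (hcop : Nat.Coprime s l)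
    (ha : 0 < a) (hb : 0 < b) :
    ∃ c > 0, ∀ j < s, ∀ h : ℝ,
      c ≤ ‖partialU s r l a b (Complex.exp (h * Complex.I)) (strandZ s r l a b j h)‖ := by
  obtain ⟨δ, hδ, hsep⟩ := (isBraid_strandZ hs r l a b).exists_separation hs
    fun j hj k hk hjk h e => hjk (strandZ_injective hs hl hcop ha hb hj hk e)
  refine ⟨δ ^ (s - 1), by positivity, fun j hj h => ?_⟩
  rw [partialU_strandZ s r l a b hj, norm_prod]
  have hcard : ((Finset.range s).erase j).card = s - 1 := by
    rw [Finset.card_erase_of_mem (Finset.mem_range.mpr hj), Finset.card_range]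
  rw [← hcard, ← Finset.prod_const]
  refine Finset.prod_le_prod (fun _ _ => hδ.le) fun k hk => ?_
  obtain ⟨hkj, hk⟩ := Finset.mem_erase.mp hk
  exact hsep j hj k (Finset.mem_range.mp hk) hkj.symm h

/-- Near the strands, and for small `t`, the derivative of the slice polynomial is close to that of
the braid polynomial at the strand. -/
theorem eventually_norm_slicePolyDeriv_sub_le (hs : 0 < s) {c : ℝ} (hc : 0 < c) (j : ℕ) :
    ∀ᶠ p : ℝ × ℂ in 𝓝 (0, 0), ∀ h : ℝ,
      ‖slicePolyDeriv s r l a b p.1 (Complex.exp (h * Complex.I)) (strandZ s r l a b j h + p.2)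
        - ContinuousLinearMap.mul ℝ ℂ
          (partialU s r l a b (Complex.exp (h * Complex.I)) (strandZ s r l a b j h))‖ ≤ c := by
  have hT : (0 : ℝ) < s * (2 * Real.pi) := by positivity
  have hZ := isBraid_strandZ hs r l a b
  refine eventually_forall_of_periodic hT
    (fun h p => by rw [hZ.periodic, exp_add_nat_mul_two_pi_mul_I]) fun h => ?_
  have hcZ := hZ.continuous j
  have h1 : Continuous fun q : ℝ × ℝ × ℂ =>
      (q.2.1, Complex.exp (q.1 * Complex.I), strandZ s r l a b j q.1 + q.2.2) := by fun_prop
  have h2 : ContinuousAt (fun q : ℝ × ℝ × ℂ => slicePolyDeriv s r l a b q.2.1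
      (Complex.exp (q.1 * Complex.I)) (strandZ s r l a b j q.1 + q.2.2)) (h, 0, 0) :=
    (continuousAt_slicePolyDeriv s r l a b _ _).comp_of_eq h1.continuousAt rfl
  have h3 : Continuous fun q : ℝ × ℝ × ℂ => ContinuousLinearMap.mul ℝ ℂ
      (partialU s r l a b (Complex.exp (q.1 * Complex.I)) (strandZ s r l a b j q.1)) := by
    have := (continuous_partialU s r l a b).comp
      (by fun_prop : Continuous fun q : ℝ × ℝ × ℂ =>
        (Complex.exp (q.1 * Complex.I), strandZ s r l a b j q.1))
    exact (ContinuousLinearMap.mul ℝ ℂ).continuous.comp this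
  have h4 : ContinuousAt (fun q : ℝ × ℝ × ℂ => ‖slicePolyDeriv s r l a b q.2.1
      (Complex.exp (q.1 * Complex.I)) (strandZ s r l a b j q.1 + q.2.2)
        - ContinuousLinearMap.mul ℝ ℂ (partialU s r l a b (Complex.exp (q.1 * Complex.I))
          (strandZ s r l a b j q.1))‖) (h, 0, 0) :=
    (h2.sub h3.continuousAt).norm
  filter_upwards [h4.eventually_lt_const (by simpa [slicePolyDeriv_zero] using hc)] with q hq
  exact hq.le

/-- The strands are almost roots of the slice polynomial for small `t`. -/
theorem eventually_norm_slicePoly_strandZ_le (hs : 0 < s) {c : ℝ} (hc : 0 < c) {j : ℕ}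
    (hj : j < s) :
    ∀ᶠ t : ℝ in 𝓝 0, ∀ h : ℝ,
      ‖slicePoly s r l a b t (Complex.exp (h * Complex.I)) (strandZ s r l a b j h)‖ ≤ c := by
  have hT : (0 : ℝ) < s * (2 * Real.pi) := by positivity
  have hZ := isBraid_strandZ hs r l a b
  refine eventually_forall_of_periodic hT
    (fun h p => by rw [hZ.periodic, exp_add_nat_mul_two_pi_mul_I]) fun h => ?_
  have hcZ := hZ.continuous j
  have h1 := ((continuous_slicePoly s r l a b).comp
    (by fun_prop : Continuous fun q : ℝ × ℝ =>
      (q.2, Complex.exp (q.1 * Complex.I), strandZ s r l a b j q.1))).norm.tendsto (h, 0)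
  have h0 : braidPoly s r l a b h (strandZ s r l a b j h) = 0 :=
    Finset.prod_eq_zero (Finset.mem_range.mpr hj) (sub_self _)
  simp only [Function.comp_apply, slicePoly_zero, h0, norm_zero] at h1
  filter_upwards [h1.eventually (gt_mem_nhds hc)] with q hq
  exact hq.le

/-- For small `t`, all roots of the slice polynomial in a given disc are near the strands. -/
theorem eventually_exists_strandZ_near (hs : 0 < s) (C : ℝ) {κ : ℝ} (hκ : 0 < κ) :
    ∀ᶠ t : ℝ in 𝓝 0, ∀ h : ℝ, ∀ w ∈ Metric.closedBall (0 : ℂ) C,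
      slicePoly s r l a b t (Complex.exp (h * Complex.I)) w = 0 →
        ∃ j < s, ‖w - strandZ s r l a b j h‖ < κ := by
  have hT : (0 : ℝ) < s * (2 * Real.pi) := by positivity
  have hZ := isBraid_strandZ hs r l a b
  refine eventually_forall_of_periodic hT
    (fun h p => by simp only [hZ.periodic, exp_add_nat_mul_two_pi_mul_I]) fun h => ?_
  refine (isCompact_closedBall _ _).eventually_forall_of_forall_eventually fun w _ => ?_
  by_cases h0 : braidPoly s r l a b h w = 0
  · obtain ⟨j, hj, e⟩ := Finset.prod_eq_zero_iff.mp h0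
    have hcZ := hZ.continuous j
    have h1 := (by fun_prop : Continuous fun q : (ℝ × ℝ) × ℂ =>
      ‖q.2 - strandZ s r l a b j q.1.1‖).tendsto ((h, 0), w)
    simp only [e, norm_zero] at h1
    filter_upwards [h1.eventually (gt_mem_nhds hκ)] with q hq _
    exact ⟨j, Finset.mem_range.mp hj, hq⟩
  · have h1 := ((continuous_slicePoly s r l a b).comp
      (by fun_prop : Continuous fun q : (ℝ × ℝ) × ℂ =>
        (q.1.2, Complex.exp (q.1.1 * Complex.I), q.2))).tendsto ((h, 0), w)
    simp only [Function.comp_apply, slicePoly_zero] at h1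
    filter_upwards [h1.eventually_ne h0] with q hq h2
    exact absurd h2 hq

/-- For small `t` the zeros on the three-sphere of the polynomial with parameters `t a`, `t b` form
a closed braid whose strands are, after rescaling by `t`, close to the lemniscate strands; they are
regular points on the sphere. -/
theorem eventually_zeros_eq_closedBraid (hs : 0 < s) (hl : 0 < l) (hcop : Nat.Coprime s l)
    (ha : 0 < a) (hb : 0 < b) {η : ℝ} (hη : 0 < η) :
    ∀ᶠ t : ℝ in 𝓝[>] 0, ∃ ζ : ℕ → ℝ → ℂ, IsBraid s r ζ ∧
      (∀ j h, ‖ζ j h - strandZ s r l a b j h‖ ≤ η) ∧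
      {x : S3 | semiholPoly s r l (t * a) (t * b) x = 0} = closedBraid s (fun j h => t * ζ j h) ∧
      ∀ x ∈ S3, semiholPoly s r l (t * a) (t * b) x = 0 →
        IsRegularPointOnS3 (semiholPoly s r l (t * a) (t * b)) x := by
  have hZ := isBraid_strandZ hs r l a b
  obtain ⟨c, hc, hslope⟩ := exists_le_norm_partialU r hs hl hcop ha hb
  obtain ⟨CZ, -, hCZ⟩ := exists_norm_strandZ_le s r l a b
  obtain ⟨C, -, hC⟩ := exists_bound_of_semiholPoly_eq_zero s r l a b
  -- a radius on which the derivative is controlled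
  have hderiv : ∀ᶠ p : ℝ × ℂ in 𝓝 (0, 0), ∀ j ∈ Finset.range s, ∀ h : ℝ,
      ‖slicePolyDeriv s r l a b p.1 (Complex.exp (h * Complex.I)) (strandZ s r l a b j h + p.2)
        - ContinuousLinearMap.mul ℝ ℂ
          (partialU s r l a b (Complex.exp (h * Complex.I)) (strandZ s r l a b j h))‖ ≤ c / 2 :=
    (Filter.eventually_all_finset _).mpr fun j _ =>
      eventually_norm_slicePolyDeriv_sub_le r hs (half_pos hc) j
  rw [Metric.eventually_nhds_iff_ball] at hderiv
  obtain ⟨κ₀, hκ₀, hderiv⟩ := hderiv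
  set κ := min (κ₀ / 2) (min η 1) with hκdef
  have hκ : 0 < κ := lt_min (half_pos hκ₀) (lt_min hη one_pos)
  have hκ0 : κ < κ₀ := (min_le_left _ _).trans_lt (half_lt_self hκ₀)
  have hκη : κ ≤ η := (min_le_right _ _).trans (min_le_left _ _)
  have hκ1 : κ ≤ 1 := (min_le_right _ _).trans (min_le_right _ _)
  -- the values at the strands are small enough for the Newton iteration
  have hsmall : ∀ᶠ t : ℝ in 𝓝 0, ∀ j ∈ Finset.range s, ∀ h : ℝ,
      ‖slicePoly s r l a b t (Complex.exp (h * Complex.I)) (strandZ s r l a b j h)‖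
        ≤ c * κ / 4 :=
    (Filter.eventually_all_finset _).mpr fun j hj =>
      eventually_norm_slicePoly_strandZ_le r hs (by positivity) (Finset.mem_range.mp hj)
  have hnear := eventually_exists_strandZ_near r (l := l) (a := a) (b := b) hs C hκ
  -- the points within distance `κ ≤ 1` of the strands have `t |w| < 1`, where the square root is
  -- differentiable
  have hdom : ∀ᶠ t : ℝ in 𝓝 0, t ^ 2 * (CZ + 1) ^ 2 < 1 := by
    have h1 := (by fun_prop : Continuous fun t : ℝ => t ^ 2 * (CZ + 1) ^ 2).tendsto 0
    simp only [ne_eq, OfNat.ofNat_ne_zero, not_false_eq_true, zero_pow, zero_mul] at h1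
    exact h1.eventually (gt_mem_nhds one_pos)
  filter_upwards [hsmall.filter_mono nhdsWithin_le_nhds, hnear.filter_mono nhdsWithin_le_nhds,
    hdom.filter_mono nhdsWithin_le_nhds, Ioo_mem_nhdsGT hκ₀] with t hsmall hnear hdom ht
  have ht0 : t ≠ 0 := ht.1.ne'
  have ht' : (t : ℂ) ≠ 0 := by exact_mod_cast ht0
  let G : ℝ → ℂ → ℂ := fun h => slicePoly s r l a b t (Complex.exp (h * Complex.I))
  let G' : ℝ → ℂ → ℂ →L[ℝ] ℂ := fun h => slicePolyDeriv s r l a b t (Complex.exp (h * Complex.I))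
  let Z := strandZ s r l a b
  let m : ℕ → ℝ → ℂ := fun j h => partialU s r l a b (Complex.exp (h * Complex.I)) (Z j h)
  have hlt : ∀ j, j % s < s := fun j => Nat.mod_lt j hs
  have hmod : ∀ j, Z (j % s) = Z j := hZ.mod_strands
  have hm : ∀ j h, c ≤ ‖m j h‖ := by
    intro j h
    have := hslope (j % s) (hlt j) h
    rwa [hZ.mod_strands] at this
  have hball : ∀ j h, ∀ w ∈ Metric.closedBall (Z j h) κ, t ^ 2 * ‖w‖ ^ 2 < 1 := by
    intro j h w hw
    refine lt_of_le_of_lt ?_ hdom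
    have h1 := norm_add_le (w - Z j h) (Z j h)
    rw [sub_add_cancel] at h1
    have h2 := mem_closedBall_iff_norm.mp hw
    have h3 := hCZ j h
    have h4 : ‖w‖ ≤ CZ + 1 := by linarith
    gcongr
  have hG : ∀ j h, ∀ w ∈ Metric.closedBall (Z j h) κ, HasFDerivAt (G h) (G' h w) w :=
    fun j h w hw => hasFDerivAt_slicePoly s r l a b _ (hball j h w hw)
  have hG' : ∀ j h, ∀ w ∈ Metric.closedBall (Z j h) κ,
      ‖G' h w - ContinuousLinearMap.mul ℝ ℂ (m j h)‖ ≤ c / 2 := by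
    intro j h w hw
    have h1 : (t, w - Z j h) ∈ Metric.ball (0 : ℝ) κ₀ ×ˢ Metric.ball (0 : ℂ) κ₀ := by
      refine ⟨?_, ?_⟩
      · rw [mem_ball_zero_iff, Real.norm_of_nonneg ht.1.le]
        exact ht.2
      · rw [mem_ball_zero_iff]
        exact (mem_closedBall_iff_norm.mp hw).trans_lt hκ0
    have h2 := hderiv _ (ball_prod_same (0 : ℝ) (0 : ℂ) κ₀ ▸ h1) (j % s)
      (Finset.mem_range.mpr (hlt j)) h
    rw [hZ.mod_strands] at h2
    simp only [Z, add_sub_cancel] at h2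
    exact h2
  have hex : ∀ j h, ∃ w, ‖w - Z j h‖ ≤ κ / 2 ∧ G h w = 0 := by
    intro j h
    refine exists_root hc hκ (hm j h) (hG j h) (hG' j h) ?_
    have := hsmall (j % s) (Finset.mem_range.mpr (hlt j)) h
    rwa [hZ.mod_strands] at this
  choose ζ hζZ hζ using hex
  have hζmem : ∀ j h, ζ j h ∈ Metric.closedBall (Z j h) κ := fun j h =>
    mem_closedBall_iff_norm.mpr ((hζZ j h).trans (by linarith))
  have hlower : ∀ j h, ∀ w ∈ Metric.closedBall (Z j h) κ, c / 2 * ‖w - ζ j h‖ ≤ ‖G h w‖ := by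
    intro j h w hw
    have := mul_norm_sub_le_norm_image_sub (hm j h) (hG j h) (hG' j h) hw (hζmem j h)
    rwa [hζ, sub_zero] at this
  have huniq : ∀ j h, ∀ w ∈ Metric.closedBall (Z j h) κ, G h w = 0 → w = ζ j h := by
    intro j h w hw h0
    have h1 := hlower j h w hw
    rw [h0, norm_zero] at h1
    have h2 : ‖w - ζ j h‖ ≤ 0 := by nlinarith [norm_nonneg (w - ζ j h)]
    exact sub_eq_zero.mp (norm_le_zero_iff.mp h2)
  have hcont : ∀ j, Continuous (ζ j) := by
    intro j
    refine continuous_iff_continuousAt.mpr fun h => ?_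
    have hcG : Continuous fun h' => ‖G h' (ζ j h)‖ :=
      ((continuous_slicePoly s r l a b).comp (by fun_prop : Continuous fun h' : ℝ =>
        (t, Complex.exp (h' * Complex.I), ζ j h))).norm
    have h1 : Tendsto (fun h' => 2 / c * ‖G h' (ζ j h)‖) (𝓝 h) (𝓝 0) := by
      have := (hcG.tendsto h).const_mul (2 / c)
      rwa [hζ, norm_zero, mul_zero] at this
    have h2 : ∀ᶠ h' in 𝓝 h, ‖Z j h' - Z j h‖ < κ / 2 := by
      have hcZ := hZ.continuous j
      have := (by fun_prop : Continuous fun h' => ‖strandZ s r l a b j h' - Z j h‖).tendsto h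
      rw [show strandZ s r l a b j h - Z j h = 0 from sub_self _, norm_zero] at this
      exact this.eventually (gt_mem_nhds (half_pos hκ))
    refine tendsto_iff_norm_sub_tendsto_zero.mpr
      (squeeze_zero' (.of_forall fun _ => norm_nonneg _) ?_ h1)
    filter_upwards [h2] with h' hh'
    have h3 : ζ j h ∈ Metric.closedBall (Z j h') κ := by
      rw [mem_closedBall_iff_norm]
      have h4 := norm_sub_le (ζ j h - Z j h) (Z j h' - Z j h)
      rw [sub_sub_sub_cancel_right] at h4
      linarith [hζZ j h]
    have h5 := hlower j h' _ h3
    rw [norm_sub_rev] at h5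
    rw [div_mul_eq_mul_div, le_div_iff₀ hc]
    linarith
  have hbraid : IsBraid s r ζ := by
    refine ⟨hcont, fun j => funext fun h => ?_, fun j h => ?_⟩
    · refine huniq j h _ ?_ (hζ _ _)
      have := hζmem (j + s) h
      rwa [show Z (j + s) = Z j from hZ.add_strands j] at this
    · have hGper : G (h + 2 * Real.pi) = G h := by
        have := exp_add_nat_mul_two_pi_mul_I h 1
        rw [Nat.cast_one, one_mul] at this
        simp only [G, this]
      refine huniq (j + r) h _ ?_ ?_
      · have := hζmem j (h + 2 * Real.pi)
        rwa [show Z j (h + 2 * Real.pi) = Z (j + r) h from hZ.add_turn j h] at this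
      · rw [← hGper]
        exact hζ _ _
  have hzero : ∀ x ∈ S3, semiholPoly s r l (t * a) (t * b) x = 0 →
      ∃ j < s, ∃ h ∈ Set.Icc 0 (2 * Real.pi), x = discCoord (t * ζ j h) h := by
    intro x hx h0
    obtain ⟨h, hh, hxh⟩ := exists_discCoord hx
    set w := (t : ℂ)⁻¹ * x.1 with hw
    have hx1 : x.1 = t * w := by rw [hw, mul_inv_cancel_left₀ ht']
    have h1 : semiholPoly s r l a b (w, x.2) = 0 := by
      rw [semiholPoly_smul s r l ht0] at h0
      exact (mul_eq_zero.mp h0).resolve_left (pow_ne_zero _ ht')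
    have hx2 : ‖x.2‖ ≤ 1 := by
      have : ‖x.1‖ ^ 2 + ‖x.2‖ ^ 2 = 1 := hx
      nlinarith [norm_nonneg x.2, sq_nonneg ‖x.1‖]
    have hwC := hC w x.2 hx2 h1
    rw [← hxh, hx1, semiholPoly_discCoord s r l a b ht0] at h0
    have h2 := (mul_eq_zero.mp h0).resolve_left (pow_ne_zero _ ht')
    obtain ⟨j, hj, hjw⟩ := hnear h w (mem_closedBall_zero_iff.mpr hwC) h2
    refine ⟨j, hj, h, hh, ?_⟩
    rw [← huniq j h w (mem_closedBall_iff_norm.mpr hjw.le) h2, ← hx1, hxh]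
  refine ⟨ζ, hbraid, fun j h => (hζZ j h).trans (by linarith), ?_, ?_⟩
  · ext x
    refine ⟨fun h0 => hzero x x.2 h0, ?_⟩
    rintro ⟨j, -, h, -, e⟩
    change semiholPoly s r l (t * a) (t * b) x = 0
    rw [e, semiholPoly_discCoord s r l a b ht0]
    exact mul_eq_zero_of_right _ (hζ j h)
  · intro x hx h0
    obtain ⟨j, -, h, -, rfl⟩ := hzero x hx h0
    exact isRegularPointOnS3_of_surjective s r l a b ht0 (hball j h _ (hζmem j h))
      (surjective_of_norm_sub_mul_le hc (hm j h) (hG' j h _ (hζmem j h)))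

end

/-! ### The isotopy between the zeros and the lemniscate link -/

theorem IsBraid.const_mul {s r : ℕ} {z : ℕ → ℝ → ℂ} (hz : IsBraid s r z) (t : ℂ) :
    IsBraid s r fun j h => t * z j h where
  continuous j := continuous_const.mul (hz.continuous j)
  add_strands j := by simp only [hz.add_strands]
  add_turn j h := by simp only [hz.add_turn]

theorem theorem3 (l s r : ℕ) (hl : 0 < l) (hs : 0 < s) (hr : 0 < r) (hcop : Nat.Coprime s l)
    (a₁ b₁ : ℝ) (ha₁ : 0 < a₁) (hb₁ : 0 < b₁) :
    ∃ ε : ℝ, 0 < ε ∧ ∀ t : ℝ, 0 < t → t < ε →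
      (∀ a b R : ℝ, 0 < a → 0 < b → a < R →
        AmbientIsotopic (M := S3)
          {x : S3 | semiholPoly s r l (t * a₁) (t * b₁) x = 0}
          {x : S3 | (x : ℂ × ℂ) ∈ invStereo '' lemniscateLink s r l a b R}) ∧
      ∀ x ∈ S3, semiholPoly s r l (t * a₁) (t * b₁) x = 0 →
        IsRegularPoint (semiholPoly s r l (t * a₁) (t * b₁)) x ∧
        IsRegularPointOnS3 (semiholPoly s r l (t * a₁) (t * b₁)) x := by
  have hs' : (0 : ℝ) < s := by exact_mod_cast hs
  have hZ := isBraid_strandZ hs r l a₁ b₁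
  obtain ⟨δ, hδ, hsep⟩ := hZ.exists_separation hs
    fun j hj k hk hjk h e => hjk (strandZ_injective hs hl hcop ha₁ hb₁ hj hk e)
  obtain ⟨C, hC0, hC⟩ := exists_norm_strandZ_le s r l a₁ b₁
  have hη : 0 < δ / (2 * s) := by positivity
  have hsmall : ∀ M : ℝ, 0 < M → ∀ᶠ t : ℝ in 𝓝[>] 0, t * M ≤ 1 := by
    intro M hM
    filter_upwards [Ioo_mem_nhdsGT (inv_pos.mpr hM)] with t ht
    exact (le_div_iff₀ hM).mp (by rw [one_div]; exact ht.2.le)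
  have key : ∀ᶠ t : ℝ in 𝓝[>] 0,
      (∀ a b R : ℝ, 0 < a → 0 < b → a < R →
        AmbientIsotopic (M := S3)
          {x : S3 | semiholPoly s r l (t * a₁) (t * b₁) x = 0}
          {x : S3 | (x : ℂ × ℂ) ∈ invStereo '' lemniscateLink s r l a b R}) ∧
      ∀ x ∈ S3, semiholPoly s r l (t * a₁) (t * b₁) x = 0 →
        IsRegularPoint (semiholPoly s r l (t * a₁) (t * b₁)) x ∧
        IsRegularPointOnS3 (semiholPoly s r l (t * a₁) (t * b₁)) x := by
    filter_upwards [eventually_zeros_eq_closedBraid r hs hl hcop ha₁ hb₁ hη,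
      hsmall (C + δ) (by positivity), hsmall (2 * a₁) (by positivity),
      hsmall (4 * C ^ 2 * (2 * s) / δ) (by positivity), self_mem_nhdsWithin]
      with t ⟨ζ, hζ, hζZ, hset, hreg⟩ ht1 ht2 ht3 ht
    have ht : 0 < t := ht
    refine ⟨fun a b R ha hb hR => ?_, fun x hx h0 => ⟨(hreg x hx h0).isRegularPoint, hreg x hx h0⟩⟩
    rw [hset, setOf_mem_invStereo_lemniscateLink s r l b ha hR]
    have hnorm : ∀ w : ℂ, ‖(t : ℂ) * w‖ = t * ‖w‖ := fun w => by
      rw [norm_mul, Complex.norm_real, Real.norm_of_nonneg ht.le]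
    have hsep' : ∀ j < s, ∀ k < s, j ≠ k → ∀ h, t * δ ≤
        ‖t * strandZ s r l a₁ b₁ j h - t * strandZ s r l a₁ b₁ k h‖ := by
      intro j hj k hk hjk h
      rw [← mul_sub, hnorm]
      exact mul_le_mul_of_nonneg_left (hsep j hj k hk hjk h) ht.le
    have hbd' : ∀ j < s, ∀ h, ‖t * strandZ s r l a₁ b₁ j h‖ ≤ 1 - t * δ := by
      intro j _ h
      rw [hnorm]
      have := mul_le_mul_of_nonneg_left (hC j h) ht.le
      linarith
    have htZ := hZ.const_mul (t : ℂ)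
    -- the zeros have strands `t ζ j`, close to `t Z j`
    have zeros_near := htZ.ambientIsotopic_of_near (hζ.const_mul t) (mul_pos ht hδ) hsep' hbd'
      (fun j _ h => by
        rw [← mul_sub, hnorm, mul_assoc]
        exact mul_le_mul_of_nonneg_left ((le_div_iff₀ (by positivity)).mp (hζZ j h)) ht.le)
    -- the lemniscate link with parameters `(t a₁, t b₁, 1)` differs from `t Z` by `O(t²)`
    have link_near := htZ.ambientIsotopic_of_near
      (isBraid_discStrand hs r l (t * a₁) (t * b₁) 1) (mul_pos ht hδ) hsep' hbd' (fun j _ h => by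
        have e : (strandX s r (t * a₁) j h + strandY s r l (t * b₁) j h * Complex.I : ℂ)
            = t * strandZ s r l a₁ b₁ j h := strandZ_smul s r l t a₁ b₁ j h
        have hle : t * ‖strandZ s r l a₁ b₁ j h‖ ≤ t * C :=
          mul_le_mul_of_nonneg_left (hC j h) ht.le
        have h1 := norm_halfPlaneToDisc_sub_le (x := strandX s r (t * a₁) j h)
          (y := strandY s r l (t * b₁) j h) (by
            rw [e, hnorm]
            nlinarith [mul_pos ht hδ])
        rw [e, hnorm] at h1
        have h2 : (t * ‖strandZ s r l a₁ b₁ j h‖) ^ 2 ≤ (t * C) ^ 2 := by gcongr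
        have h3 : t * (4 * C ^ 2 * (2 * s)) ≤ δ := by
          rw [← mul_div_assoc, div_le_one hδ] at ht3
          exact ht3
        calc _ ≤ 4 * (t * C) ^ 2 * (2 * s) := by
              refine mul_le_mul_of_nonneg_right (h1.trans ?_) (by positivity)
              linarith
          _ = t * (t * (4 * C ^ 2 * (2 * s))) := by ring
          _ ≤ t * δ := mul_le_mul_of_nonneg_left h3 ht.le)
    exact (zeros_near.symm.trans link_near).trans (ambientIsotopic_discStrand hs hl hcop
      (mul_pos ht ha₁) (mul_pos ht hb₁) (by linarith) ha hb hR)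
  obtain ⟨ε, hε, H⟩ := (nhdsGT_basis (0 : ℝ)).eventually_iff.mp key
  exact ⟨ε, hε, fun t h0 h1 => H ⟨h0, h1⟩⟩
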